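/- **Setting.** Let $F$ be a non-Archimedean local field with ring of integers $O$, maximal ideal $\mathfrak p=\varpi O$ and finite residue field $\mathbb F=O/\mathfrak p$ of odd characteristic. Fix a continuous unitary character $\tau$ of the additive group $F$ with $\{x\in F\mid \tau(xy)=1 \text{ for all } y\in O\}=O$. Let $l\ge 2$ and $r=2l-1$, put $O_i=O/\mathfrak p^i$ and $G_i=GL_n(O_i)$, and for $0<i<r$ let $K_i=\ker(G_r\to G_i)$. Let $\beta\in M_n(O)$, with reductions $\overline\beta\in M_n(\mathbb F)$ and $\beta_r\in M_n(O_r)$. Let $K_{l-1}(\mathbb F[\overline\beta])$ be the group of those $1_n+\varpi^{l-1}X \bmod \mathfrak p^r$ in $K_{l-1}$ for which $X \bmod \mathfrak p\in\mathbb F[\overline\beta]$. Let $\psi_\beta$ be the character $1_n+\varpi^lX \bmod \mathfrak p^r\mapsto\tau(\varpi^{-(l-1)}\operatorname{tr}(X\beta))$ of $K_l$. Let $Y(\psi_\beta)$ be the set of homomorphisms $\psi:K_{l-1}(\mathbb F[\overline\beta])\to\mathbb C^\times$ with $\psi|_{K_l}=\psi_\beta$, and let $\mathcal C=(O_r[\beta_r])^\times$.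 For $\psi\in Y(\psi_\beta)$, let $\pi_\psi$ be an irreducible complex representation of $K_{l-1}$ whose restriction to $K_{l-1}(\mathbb F[\overline\beta])$ contains $\psi$. For each $\varepsilon\in\mathcal C$ let $U(\varepsilon)$ be an invertible operator on the space of $\pi_\psi$ with $\pi_\psi(\varepsilon k\varepsilon^{-1})=U(\varepsilon)\pi_\psi(k)U(\varepsilon)^{-1}$ for all $k\in K_{l-1}$. Write $U(\varepsilon)U(\eta)=c_U(\varepsilon,\eta)\,U(\varepsilon\eta)$ with $c_U(\varepsilon,\eta)\in\mathbb C^\times$, and let $c(\psi)\in H^2(\mathcal C,\mathbb C^\times)$ be the class of the 2-cocycle $c_U$, where $\mathcal C$ acts trivially on $\mathbb C^\times$. **Theorem.** Suppose that the characteristic polynomial of $\overline\beta$ is separable. Then for every $\psi\in Y(\psi_\beta)$ the class $c(\psi)$ exists (that is, $\pi_\psi$, the $U(\varepsilon)$ and the cocycle $c_U$ exist) and is trivial, whatever choice of $\pi_\psi$ and of the $U(\varepsilon)$ is made. In particular this holds in the cuspidal case, that is, when the characteristic polynomial of $\overline\beta$ is irreducible over $\mathbb F$. -/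

import Mathlib

open scoped Matrix

/-! ### Second cohomology with trivial action -/

/-- The group `Z²(G, A)` of 2-cocycles of `G` in `A` (written multiplicatively), where `G` acts
trivially on `A`. -/
def twoCocycles (G A : Type*) [Group G] [CommGroup A] : Subgroup (G × G → A) where
  carrier := {c | ∀ g h j : G, c (g * h, j) * c (g, h) = c (h, j) * c (g, h * j)}
  one_mem' := fun g h j => by simp
  mul_mem' := fun {a b} ha hb g h j => by
    have h1 := ha g h j
    have h2 := hb g h j
    simp only [Pi.mul_apply]
    rw [mul_mul_mul_comm, h1, h2, mul_mul_mul_comm]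
  inv_mem' := fun {a} ha g h j => by
    have h1 := ha g h j
    simp only [Pi.inv_apply]
    rw [← mul_inv, h1, mul_inv]

/-- The group `B²(G, A)` of 2-coboundaries `(g, h) ↦ x h * (x (g * h))⁻¹ * x g` of `G` in `A`,
where `G` acts trivially on `A`. -/
def twoCoboundaries (G A : Type*) [Group G] [CommGroup A] : Subgroup (G × G → A) where
  carrier := {c | ∃ x : G → A, ∀ g h : G, c (g, h) = x h * (x (g * h))⁻¹ * x g}
  one_mem' := ⟨1, fun g h => by simp⟩
  mul_mem' := by
    rintro a b ⟨x, hx⟩ ⟨y, hy⟩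
    refine ⟨x * y, fun g h => ?_⟩
    simp only [Pi.mul_apply, hx, hy, mul_inv]
    rw [mul_mul_mul_comm, mul_mul_mul_comm (x h)]
  inv_mem' := by
    rintro a ⟨x, hx⟩
    refine ⟨x⁻¹, fun g h => ?_⟩
    simp only [Pi.inv_apply, hx, mul_inv]

/-- `H²(G, A) = Z²(G, A) / B²(G, A)` (written multiplicatively), for the trivial action of `G`
on `A`. Every coboundary is a cocycle, so this is the usual quotient. -/
abbrev trivialH2 (G A : Type*) [Group G] [CommGroup A] : Type _ :=
  twoCocycles G A ⧸ (twoCoboundaries G A).subgroupOf (twoCocycles G A)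

lemma twoCoboundaries_le_twoCocycles (G A : Type*) [Group G] [CommGroup A] :
    twoCoboundaries G A ≤ twoCocycles G A := by
  rintro c ⟨x, hx⟩ g h j
  simp only [hx, mul_assoc]
  apply Additive.ofMul.injective
  simp only [ofMul_mul, ofMul_inv]
  abel

/-! ### Congruence subgroups of `GL_n(O / 𝔭^r)` -/

section Congruence

variable {O : Type*} [CommRing O] [IsLocalRing O]

/-- Reduction `M_n(O) → M_n(O / 𝔭^r)`. -/
abbrev redPow {n : ℕ} (r : ℕ) (X : Matrix (Fin n) (Fin n) O) :
    Matrix (Fin n) (Fin n) (O ⧸ IsLocalRing.maximalIdeal O ^ r) :=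
  X.map (Ideal.Quotient.mk (IsLocalRing.maximalIdeal O ^ r))

/-- Reduction `M_n(O) → M_n(𝔽)`, where `𝔽 = O / 𝔭` is the residue field. -/
noncomputable abbrev redRes {n : ℕ} (X : Matrix (Fin n) (Fin n) O) :
    Matrix (Fin n) (Fin n) (IsLocalRing.ResidueField O) :=
  X.map (IsLocalRing.residue O)

variable (O) in
/-- `G_r = GL_n(O / 𝔭^r)`. -/
abbrev GLmod (n r : ℕ) : Type _ :=
  Matrix.GeneralLinearGroup (Fin n) (O ⧸ IsLocalRing.maximalIdeal O ^ r)

variable (O) in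
/-- `K_i`, the kernel of the canonical homomorphism `G_r → G_i`, for `i ≤ r`. -/
def congruenceSubgroup (n : ℕ) {i r : ℕ} (hir : i ≤ r) : Subgroup (GLmod O n r) :=
  (Matrix.GeneralLinearGroup.map
    (Ideal.Quotient.factorPow (IsLocalRing.maximalIdeal O) hir)).ker

instance congruenceSubgroup_normal (n : ℕ) {i r : ℕ} (hir : i ≤ r) :
    (congruenceSubgroup O n hir).Normal :=
  inferInstanceAs (MonoidHom.ker _).Normal

/-- A lift of an element of `K_i`, `0 < i ≤ r`, is congruent to `1` modulo `𝔭`. -/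
lemma redRes_eq_one_of_mem {n i r : ℕ} (hi : 0 < i) (hir : i ≤ r)
    {k : GLmod O n r} (hk : k ∈ congruenceSubgroup O n hir)
    {Y : Matrix (Fin n) (Fin n) O} (hY : k.val = redPow r Y) : redRes Y = 1 := by
  ext a b
  have h1 : (Matrix.GeneralLinearGroup.map
      (Ideal.Quotient.factorPow (IsLocalRing.maximalIdeal O) hir) k).val a b =
      (1 : Matrix (Fin n) (Fin n) (O ⧸ IsLocalRing.maximalIdeal O ^ i)) a b := by
    rw [MonoidHom.mem_ker.mp hk]; rfl
  have h2 : (Ideal.Quotient.factorPow (IsLocalRing.maximalIdeal O) hir) (k.val a b) =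
      (1 : Matrix (Fin n) (Fin n) (O ⧸ IsLocalRing.maximalIdeal O ^ i)) a b := h1
  have h0 : k.val a b = Ideal.Quotient.mk (IsLocalRing.maximalIdeal O ^ r) (Y a b) := by
    rw [hY]; rfl
  rw [h0, Ideal.Quotient.factorPow, Ideal.Quotient.factor_mk] at h2
  have h3 : Y a b - (1 : Matrix (Fin n) (Fin n) O) a b ∈ IsLocalRing.maximalIdeal O ^ i := by
    rw [← Ideal.Quotient.eq, h2]
    by_cases hab : a = b <;> simp [Matrix.one_apply, hab]
  have h4 := Ideal.pow_le_self hi.ne' h3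
  have h5 : IsLocalRing.residue O (Y a b - (1 : Matrix (Fin n) (Fin n) O) a b) = 0 :=
    (IsLocalRing.residue_eq_zero_iff _).mpr h4
  rw [map_sub, sub_eq_zero] at h5
  have h6 : redRes Y a b = IsLocalRing.residue O ((1 : Matrix (Fin n) (Fin n) O) a b) := h5
  rw [h6]
  by_cases hab : a = b <;> simp [Matrix.one_apply, hab]

/-- `K_i(V)` for an `𝔽`-subspace `V` of `M_n(𝔽)` and `0 < i ≤ r`: the inverse image of `V` under
`K_i → M_n(𝔽)`, `1 + ϖ^i X mod 𝔭^r ↦ X mod 𝔭`. -/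
noncomputable def congruenceSubgroupOf {n i r : ℕ} (hi : 0 < i) (hir : i ≤ r) (ϖ : O)
    (V : Submodule (IsLocalRing.ResidueField O)
      (Matrix (Fin n) (Fin n) (IsLocalRing.ResidueField O))) :
    Subgroup (GLmod O n r) where
  carrier := {k | k ∈ congruenceSubgroup O n hir ∧
    ∃ X : Matrix (Fin n) (Fin n) O, redRes X ∈ V ∧ k.val = redPow r (1 + ϖ ^ i • X)}
  one_mem' := ⟨one_mem _, 0, by simp [redRes, Matrix.map_zero], by
    simp [redPow, Matrix.map_one]⟩
  mul_mem' := by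
    rintro k k' ⟨hk, X, hX, hkX⟩ ⟨hk', X', hX', hkX'⟩
    refine ⟨mul_mem hk hk', X + (1 + ϖ ^ i • X) * X', ?_, ?_⟩
    · have h1 := redRes_eq_one_of_mem hi hir hk hkX
      have h2 : redRes (X + (1 + ϖ ^ i • X) * X') = redRes X + redRes X' := by
        rw [redRes, Matrix.map_add _ (map_add _), Matrix.map_mul, ← redRes, ← redRes, h1, one_mul]
      rw [h2]
      exact add_mem hX hX'
    · rw [Units.val_mul, hkX, hkX', redPow, redPow, ← Matrix.map_mul]
      congr 1
      simp only [mul_add, add_mul, mul_one, one_mul, smul_add, Matrix.mul_smul, Matrix.smul_mul]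
      abel
  inv_mem' := by
    rintro k ⟨hk, X, hX, hkX⟩
    obtain ⟨Y, hY⟩ : ∃ Y : Matrix (Fin n) (Fin n) O, (k⁻¹).val = redPow r Y := by
      choose f hf using fun a b => Ideal.Quotient.mk_surjective ((k⁻¹).val a b)
      exact ⟨Matrix.of f, by ext a b; simp [hf]⟩
    refine ⟨inv_mem hk, -(X * Y), ?_, ?_⟩
    · have h1 := redRes_eq_one_of_mem hi hir (inv_mem hk) hY
      have h2 : redRes (-(X * Y)) = -redRes X := by
        rw [redRes, Matrix.map_neg _ (map_neg _), Matrix.map_mul, ← redRes, ← redRes, h1, mul_one]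
      rw [h2]
      exact neg_mem hX
    · have h1 : k.val * (k⁻¹).val = 1 := by rw [← Units.val_mul, mul_inv_cancel, Units.val_one]
      rw [hkX] at h1
      nth_rewrite 1 [hY] at h1
      rw [redPow, redPow, ← Matrix.map_mul, add_mul, one_mul, Matrix.smul_mul,
        Matrix.map_add _ (map_add _), ← redPow, ← hY] at h1
      rw [redPow, Matrix.map_add _ (map_add _), Matrix.map_one _ (map_zero _) (map_one _),
        smul_neg, Matrix.map_neg _ (map_neg _), ← sub_eq_add_neg]
      exact eq_sub_of_add_eq h1

lemma congruenceSubgroupOf_le {n i r : ℕ} (hi : 0 < i) (hir : i ≤ r) (ϖ : O)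
    (V : Submodule (IsLocalRing.ResidueField O)
      (Matrix (Fin n) (Fin n) (IsLocalRing.ResidueField O))) :
    congruenceSubgroupOf hi hir ϖ V ≤ congruenceSubgroup O n hir :=
  fun _ hk => hk.1

end Congruence

/-! ### The groups attached to `β`, for `r = 2l - 1` and `l ≥ 2` -/

section Beta

variable {O : Type*} [CommRing O] [IsLocalRing O]

/-- The subspace `𝔽[β̄]` of `M_n(𝔽)`. -/
noncomputable abbrev residueAlgebra {n : ℕ} (β : Matrix (Fin n) (Fin n) O) :
    Submodule (IsLocalRing.ResidueField O)
      (Matrix (Fin n) (Fin n) (IsLocalRing.ResidueField O)) :=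
  Subalgebra.toSubmodule (Algebra.adjoin (IsLocalRing.ResidueField O) {redRes β})

variable (O) in
/-- `K_{l-1} ⊆ G_{2l-1}`. -/
abbrev KPred (n l : ℕ) : Subgroup (GLmod O n (2 * l - 1)) :=
  congruenceSubgroup O n (i := l - 1) (r := 2 * l - 1) (by omega)

/-- `K_{l-1}(𝔽[β̄]) ⊆ K_{l-1}`. -/
noncomputable abbrev KPredBeta {n l : ℕ} (hl : 2 ≤ l) (ϖ : O) (β : Matrix (Fin n) (Fin n) O) :
    Subgroup (GLmod O n (2 * l - 1)) :=
  congruenceSubgroupOf (i := l - 1) (r := 2 * l - 1) (by omega) (by omega) ϖ (residueAlgebra β)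

/-- `𝒞 = (O_r[β_r])ˣ`, the unit group of the `O_r`-subalgebra of `M_n(O_r)` generated by the
reduction `β_r` of `β`, where `O_r = O / 𝔭^r` and `r = 2l - 1`. -/
abbrev CBeta {n : ℕ} (l : ℕ) (β : Matrix (Fin n) (Fin n) O) : Type _ :=
  (Algebra.adjoin (O ⧸ IsLocalRing.maximalIdeal O ^ (2 * l - 1)) {redPow (2 * l - 1) β})ˣ

/-- The inclusion `𝒞 → G_r`. -/
def CBeta.toGL {n l : ℕ} (β : Matrix (Fin n) (Fin n) O) :
    CBeta l β →* GLmod O n (2 * l - 1) :=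
  Units.map (Subalgebra.val (Algebra.adjoin (O ⧸ IsLocalRing.maximalIdeal O ^ (2 * l - 1))
    {redPow (2 * l - 1) β}) : _ →* _)

/-- `Y(ψ_β)`: the homomorphisms `ψ : K_{l-1}(𝔽[β̄]) → ℂˣ` with `ψ|_{K_l} = ψ_β`, where
`ψ_β (1 + ϖ^l X mod 𝔭^r) = τ (ϖ^{-(l-1)} tr (X β))` for `X ∈ M_n(O)`. -/
def YSet {F : Type*} [Field F] [Algebra O F] (τ : AddChar F Circle) {n l : ℕ} (hl : 2 ≤ l)
    (ϖ : O) (β : Matrix (Fin n) (Fin n) O) : Set (KPredBeta hl ϖ β →* ℂˣ) :=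
  {ψ | ∀ (k : KPredBeta hl ϖ β) (X : Matrix (Fin n) (Fin n) O),
    k.1.val = redPow (2 * l - 1) (1 + ϖ ^ l • X) →
      ((ψ k : ℂˣ) : ℂ) =
        τ ((algebraMap O F ϖ ^ (l - 1))⁻¹ * algebraMap O F (X * β).trace)}

/-- `π` is (a model of) `π_ψ`: an irreducible complex representation of `K_{l-1}` whose restriction
to `K_{l-1}(𝔽[β̄])` contains `ψ`. -/
def IsPiPsi {n l : ℕ} {hl : 2 ≤ l} {ϖ : O} {β : Matrix (Fin n) (Fin n) O}
    (ψ : KPredBeta hl ϖ β →* ℂˣ) {H : Type*} [AddCommGroup H] [Module ℂ H]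
    (π : Representation ℂ (KPred O n l) H) : Prop :=
  π.IsIrreducible ∧ ∃ v : H, v ≠ 0 ∧
    ∀ k : KPredBeta hl ϖ β,
      π ⟨k.1, congruenceSubgroupOf_le _ _ ϖ _ k.2⟩ v = ((ψ k : ℂˣ) : ℂ) • v

/-- `x` is the Schur multiplier `c(ψ) ∈ H²(𝒞, ℂˣ)`: the class of a 2-cocycle `c_U` defined by
`U(ε) U(η) = c_U(ε, η) U(εη)`, where `U(ε)` are invertible operators on the space of `π_ψ` with
`π_ψ(ε k ε⁻¹) = U(ε) π_ψ(k) U(ε)⁻¹` for all `k ∈ K_{l-1}`. -/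
def IsSchurMultiplier {n l : ℕ} {hl : 2 ≤ l} {ϖ : O} {β : Matrix (Fin n) (Fin n) O}
    (ψ : KPredBeta hl ϖ β →* ℂˣ) (x : trivialH2 (CBeta l β) ℂˣ) : Prop :=
  ∃ (H : Type) (_ : AddCommGroup H) (_ : Module ℂ H) (π : Representation ℂ (KPred O n l) H)
    (U : CBeta l β → (H ≃ₗ[ℂ] H)) (c : twoCocycles (CBeta l β) ℂˣ),
    IsPiPsi ψ π ∧
    (∀ (ε : CBeta l β) (k : KPred O n l),
      π (MulAut.conjNormal (CBeta.toGL β ε) k) =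
        (U ε).toLinearMap ∘ₗ π k ∘ₗ (U ε).symm.toLinearMap) ∧
    (∀ ε η : CBeta l β, (U ε).toLinearMap ∘ₗ (U η).toLinearMap =
      ((c.1 (ε, η) : ℂˣ) : ℂ) • (U (ε * η)).toLinearMap) ∧
    x = QuotientGroup.mk c

/-- The hypothesis on Schur multipliers: for all `ψ ∈ Y(ψ_β)`, the class `c(ψ)` exists and is
trivial (however the representation `π_ψ` and the operators `U(ε)` are chosen). -/
def SchurHypothesis {F : Type*} [Field F] [Algebra O F] (τ : AddChar F Circle) {n l : ℕ}
    (hl : 2 ≤ l) (ϖ : O) (β : Matrix (Fin n) (Fin n) O) : Prop :=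
  ∀ ψ ∈ YSet τ hl ϖ β,
    (∃ x : trivialH2 (CBeta l β) ℂˣ, IsSchurMultiplier ψ x) ∧
    ∀ x : trivialH2 (CBeta l β) ℂˣ, IsSchurMultiplier ψ x → x = 1

end Beta

open scoped ValuativeRel

/-! ### Heisenberg systems of operators -/

/-! Since 3(l-1) ≥ r and 2 is invertible, every element of K_{l-1} is a truncated exponential E(X) =
1 + ϖ^{l-1}X + ½ϖ^{2l-2}X², and E(X)E(Y) equals E(X+Y) times an element of K_l built from ½[X,Y]. As
K_l is central in K_{l-1}, it acts on π_ψ through ψ_β. Dividing π_ψ(E(X)) by τ(ϖ^{-l} tr(Xβ)) gives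
operators A(X) that depend only on X mod 𝔭 and satisfy A(X)A(Y) = θ(½ tr([X,Y]β̄)) A(X+Y), where θ(a
mod 𝔭) = τ(ϖ⁻¹a) (`exists_isMatrixHeisenberg`).

The radical of the form tr([X,Y]β̄) is the centralizer of β̄. Separability makes M_n(𝔽) the direct
sum of this centralizer, on which A is scalar, and W, the image of ad β̄, on which the form is
nondegenerate. So π_ψ is a Heisenberg representation of W. An ε in 𝒞 lifts to a polynomial in β, so
conjugation by it fixes the centralizer and preserves W and the form; averaging a rank one operator
over W produces U(ε) (`IsHeisenbergSystem.exists_intertwiner`).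

For triviality, let d = dim π_ψ and J = d⁻¹ ∑_{u ∈ W} A(u), the operator of u ↦ -u. Since d² = |W|,
J² = 1; since A(u) is traceless for u ≠ 0, tr J = 1. Each U(ε) permutes the summands, so it commutes
with J and preserves the two eigenspaces of J, whose dimensions are b + 1 and b. The determinants of
U on them show that c^{b+1} and c^b are coboundaries, hence so is their quotient c
(`exists_coboundary_of_involution`). -/

/-- A family `A` of operators indexed by an additive group `W`, multiplicative up to a
nondegenerate alternating multiplier `B`, whose commutant consists of scalars. -/
structure IsHeisenbergSystem {W H : Type*} [AddCommGroup W] [AddCommGroup H] [Module ℂ H]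
    (B : W → W → ℂ) (A : W → Module.End ℂ H) : Prop where
  add_left : ∀ u v w, B (u + v) w = B u w * B v w
  skew : ∀ u v, B u v * B v u = 1
  self : ∀ u, B u u = 1
  -- The square appears because the commutator of `A v` and `A u` is `B v u ^ 2`, not `B v u`.
  nondegenerate : ∀ u, u ≠ 0 → ∃ v, B v u ^ 2 ≠ 1
  map_zero : A 0 = 1
  map_mul : ∀ u v, A u * A v = B u v • A (u + v)
  commutant : ∀ T : Module.End ℂ H, (∀ u, T * A u = A u * T) → ∃ c : ℂ, T = c • 1

namespace IsHeisenbergSystem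

variable {W H : Type*} [AddCommGroup W] [AddCommGroup H] [Module ℂ H]
  {B : W → W → ℂ} {A : W → Module.End ℂ H} (h : IsHeisenbergSystem B A)

include h

lemma ne_zero (u v : W) : B u v ≠ 0 := left_ne_zero_of_mul_eq_one (h.skew u v)

lemma eq_inv (u v : W) : B u v = (B v u)⁻¹ := eq_inv_of_mul_eq_one_left (h.skew u v)

lemma add_right (u v w : W) : B u (v + w) = B u v * B u w := by
  rw [h.eq_inv, h.add_left, mul_inv, ← h.eq_inv, ← h.eq_inv]

lemma zero_left (u : W) : B 0 u = 1 := by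
  have := h.add_left 0 0 u
  rw [add_zero] at this
  exact (mul_eq_left₀ (h.ne_zero 0 u)).mp this.symm

lemma zero_right (u : W) : B u 0 = 1 := by
  rw [h.eq_inv, h.zero_left, inv_one]

lemma neg_left (u v : W) : B (-u) v = B v u := by
  rw [h.eq_inv v u]
  refine eq_inv_of_mul_eq_one_left ?_
  rw [← h.add_left, neg_add_cancel, h.zero_left]

lemma neg_right (u v : W) : B u (-v) = B v u := by
  rw [h.eq_inv, h.neg_left, ← h.eq_inv]

lemma map_neg_mul (u : W) : A (-u) * A u = 1 := by
  rw [h.map_mul, h.neg_left, h.self, neg_add_cancel, h.map_zero, one_smul]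

lemma conj (u v : W) : A v * A u * A (-v) = B v u ^ 2 • A u := by
  rw [h.map_mul, smul_mul_assoc, h.map_mul, smul_smul, h.neg_right, h.add_right, h.self, one_mul,
    add_neg_cancel_comm, sq]

/-- Conjugation by some `A v` multiplies `A u` by a factor other than 1 but preserves the trace. -/
lemma trace_eq_zero {u : W} (hu : u ≠ 0) : LinearMap.trace ℂ H (A u) = 0 := by
  obtain ⟨v, hv⟩ := h.nondegenerate u hu
  have h1 := congrArg (LinearMap.trace ℂ H) (h.conj u v)
  rw [LinearMap.trace_mul_comm, ← mul_assoc, h.map_neg_mul, one_mul, map_smul, smul_eq_mul] at h1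
  by_contra h0
  exact hv (mul_right_cancel₀ h0 (by rw [one_mul, ← h1]))

variable [Fintype W]

lemma sum_eq_zero {w : W} (hw : w ≠ 0) : ∑ u, B u w = 0 := by
  obtain ⟨v, hv⟩ := h.nondegenerate w hw
  have h1 : ∑ u, B u w = B v w * ∑ u, B u w := by
    rw [Finset.mul_sum, ← Equiv.sum_comp (Equiv.addLeft v)]
    simp [h.add_left]
  by_contra h0
  have h2 : B v w = 1 := mul_right_cancel₀ h0 (by rw [one_mul, ← h1])
  exact hv (by rw [h2, one_pow])

/-- Up to scale, the sum of all `A u` is the parity operator, which turns `A v` into `A (-v)`. -/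
lemma mul_sum (v : W) : A v * ∑ u, A u = (∑ u, A u) * A (-v) := by
  have h1 : A v * ∑ u, A u = ∑ u, B v u • A u := by
    rw [Finset.mul_sum, ← Equiv.sum_comp (Equiv.addLeft v) (fun u => B v u • A u)]
    simp [h.add_right, h.self, h.map_mul]
  have h2 : (∑ u, A u) * A (-v) = ∑ u, B v u • A u := by
    rw [Finset.sum_mul, ← Equiv.sum_comp (Equiv.addRight (-v)) (fun u => B v u • A u)]
    simp [h.add_right, h.neg_right, h.self, h.map_mul]
  rw [h1, h2]

/-- With w = u + v the product is ∑_w (∑_u B u w) A w, and orthogonality of characters leaves only w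
= 0. -/
lemma sum_mul_sum : (∑ u, A u) * ∑ u, A u = (Fintype.card W : ℂ) • 1 := by
  classical
  have h1 : ∀ u, A u * ∑ v, A v = ∑ w, B u w • A w := fun u => by
    rw [Finset.mul_sum, ← Equiv.sum_comp (Equiv.addLeft u) (fun w => B u w • A w)]
    simp [h.add_right, h.self, h.map_mul]
  rw [Finset.sum_mul]
  simp_rw [h1]
  rw [Finset.sum_comm]
  simp_rw [← Finset.sum_smul]
  rw [Finset.sum_eq_single 0]
  · simp [h.zero_right, h.map_zero]
  · intro w _ hw
    rw [h.sum_eq_zero hw, zero_smul]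
  · simp

variable [FiniteDimensional ℂ H]

lemma trace_sum_smul (c : W → ℂ) (g : W ≃+ W) :
    LinearMap.trace ℂ H (∑ u, c u • A (g u)) = c 0 * Module.finrank ℂ H := by
  rw [map_sum, Finset.sum_eq_single 0]
  · rw [_root_.map_zero, h.map_zero, map_smul, LinearMap.trace_one, smul_eq_mul]
  · intro u _ hu
    rw [map_smul, h.trace_eq_zero (by simpa using hu), smul_zero]
  · simp

lemma trace_sum : LinearMap.trace ℂ H (∑ u, A u) = Module.finrank ℂ H := by
  simpa using h.trace_sum_smul 1 (AddEquiv.refl W)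

variable [Nontrivial H]

/-- Schur averaging: the multipliers of `A v * A u` and `A (-u) * A (-v)` cancel by `skew`, so the
sum commutes with every `A v`; comparing traces identifies the scalar. -/
lemma sum_conj (T : Module.End ℂ H) : ∑ u, A u * T * A (-u) =
    (Fintype.card W * LinearMap.trace ℂ H T / Module.finrank ℂ H : ℂ) • 1 := by
  obtain ⟨c, hc⟩ := h.commutant (∑ u, A u * T * A (-u)) fun v => by
    have h1 : A v * (∑ u, A u * T * A (-u)) * A (-v) = ∑ u, A u * T * A (-u) := by
      rw [Finset.mul_sum, Finset.sum_mul,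
        ← Equiv.sum_comp (Equiv.addLeft v) (fun u => A u * T * A (-u))]
      refine Finset.sum_congr rfl fun u _ => ?_
      have e1 : A v * A u = B v u • A (v + u) := h.map_mul v u
      have e2 : A (-u) * A (-v) = B u v • A (-(v + u)) := by
        rw [h.map_mul, h.neg_left, h.neg_left, neg_add_rev]
      calc A v * (A u * T * A (-u)) * A (-v) = (A v * A u) * T * (A (-u) * A (-v)) := by
            simp only [mul_assoc]
        _ = _ := by
            rw [e1, e2, smul_mul_assoc, smul_mul_assoc, mul_smul_comm, smul_smul, h.skew, one_smul]
            rfl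
    calc _ = A v * (∑ u, A u * T * A (-u)) * A (-v) * A v := by rw [h1]
      _ = _ := by rw [mul_assoc, h.map_neg_mul, mul_one]
  have hd : (Module.finrank ℂ H : ℂ) ≠ 0 := Nat.cast_ne_zero.mpr Module.finrank_pos.ne'
  have h2 : ∀ u, LinearMap.trace ℂ H (A u * T * A (-u)) = LinearMap.trace ℂ H T := fun u => by
    rw [LinearMap.trace_mul_comm, ← mul_assoc, h.map_neg_mul, one_mul]
  have h3 := congrArg (LinearMap.trace ℂ H) hc
  rw [map_sum] at h3
  simp only [h2, Finset.sum_const, Finset.card_univ, nsmul_eq_mul, map_smul, LinearMap.trace_one,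
    smul_eq_mul] at h3
  rw [hc, h3, mul_div_cancel_right₀ _ hd]

lemma finrank_sq : (Module.finrank ℂ H : ℂ) ^ 2 = Fintype.card W := by
  have hd : (Module.finrank ℂ H : ℂ) ≠ 0 := Nat.cast_ne_zero.mpr Module.finrank_pos.ne'
  obtain ⟨y, hy⟩ := exists_ne (0 : H)
  have hφ : ∃ φ : Module.Dual ℂ H, φ y = 1 := by
    obtain ⟨φ, hφ⟩ := Module.Projective.exists_dual_ne_zero ℂ hy
    exact ⟨(φ y)⁻¹ • φ, by simp [hφ]⟩
  obtain ⟨φ, hφ⟩ := hφ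
  -- Apply `sum_conj` to the rank one operator φ ⊗ x, evaluate at y, and read the result as a
  -- function of x. The trace then compares d with |W| / d.
  have h1 : ∑ u, φ (A (-u) y) • A u = (Fintype.card W / Module.finrank ℂ H : ℂ) • φ.smulRight y := by
    ext x
    have := congrArg (fun T : Module.End ℂ H => T y) (h.sum_conj (φ.smulRight x))
    simp only [LinearMap.trace_smulRight] at this
    simpa [LinearMap.sum_apply, mul_div_right_comm, mul_smul] using this
  have h2 := congrArg (LinearMap.trace ℂ H) h1
  have h3 := h.trace_sum_smul (fun u => φ (A (-u) y)) (AddEquiv.refl W)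
  simp only [AddEquiv.refl_apply] at h3
  rw [h3, map_smul, LinearMap.trace_smulRight] at h2
  simp [h.map_zero, hφ] at h2
  field_simp at h2
  exact h2

/-- Every automorphism of `W` preserving the multiplier is implemented by an operator. -/
lemma exists_intertwiner (g : W ≃+ W) (hg : ∀ u v, B (g u) (g v) = B u v) :
    ∃ U : H ≃ₗ[ℂ] H, ∀ u, A (g u) * U.toLinearMap = U.toLinearMap * A u := by
  have hd : (Module.finrank ℂ H : ℂ) ≠ 0 := Nat.cast_ne_zero.mpr Module.finrank_pos.ne'
  obtain ⟨y, hy⟩ := exists_ne (0 : H)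
  obtain ⟨φ, hφ⟩ := Module.Projective.exists_dual_ne_zero ℂ hy
  -- This operator has trace φ(y) d ≠ 0. It sends x to the value at y of the average `U` built from
  -- x below, so x can be chosen with `U y ≠ 0`.
  have hQ : ∑ u, φ (A (-u) y) • A (g u) ≠ 0 := fun h0 => by
    have := h.trace_sum_smul (fun u => φ (A (-u) y)) g
    rw [h0] at this
    simp [h.map_zero, hφ, hd] at this
  obtain ⟨x, hx⟩ : ∃ x, (∑ u, φ (A (-u) y) • A (g u)) x ≠ 0 := by
    by_contra! h0
    exact hQ (LinearMap.ext h0)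
  set U : Module.End ℂ H := ∑ u, A (g u) * φ.smulRight x * A (-u) with hU
  have hUy : U y ≠ 0 := by
    convert hx using 1
    simp [hU, LinearMap.sum_apply]
  have hcomm : ∀ v, A (g v) * U = U * A v := fun v => by
    have h1 : A (g v) * U * A (-v) = U := by
      rw [hU, Finset.mul_sum, Finset.sum_mul,
        ← Equiv.sum_comp (Equiv.addLeft v) (fun u => A (g u) * φ.smulRight x * A (-u))]
      refine Finset.sum_congr rfl fun u _ => ?_
      have e1 : A (g v) * A (g u) = B v u • A (g (v + u)) := by rw [h.map_mul, hg, map_add]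
      have e2 : A (-u) * A (-v) = B u v • A (-(v + u)) := by
        rw [h.map_mul, h.neg_left, h.neg_left, neg_add_rev]
      calc A (g v) * (A (g u) * φ.smulRight x * A (-u)) * A (-v)
          = (A (g v) * A (g u)) * φ.smulRight x * (A (-u) * A (-v)) := by
            simp only [mul_assoc]
        _ = _ := by
            rw [e1, e2, smul_mul_assoc, smul_mul_assoc, mul_smul_comm, smul_smul, h.skew, one_smul]
            rfl
    calc _ = A (g v) * U * A (-v) * A v := by rw [mul_assoc _ _ (A v), h.map_neg_mul, mul_one]
      _ = _ := by rw [h1]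
  obtain ⟨χ, hχ⟩ := Module.Projective.exists_dual_ne_zero ℂ hUy
  -- The average of (χ ⊗ y) ∘ U is a nonzero scalar; moving `U` to the right past each `A (-u)`
  -- exhibits that scalar as a left multiple of `U`, so `U` is injective.
  have h1 := h.sum_conj (χ.smulRight y * U)
  have h2 : LinearMap.trace ℂ H (χ.smulRight y * U) = χ (U y) := by
    have : χ.smulRight y * U = (χ ∘ₗ U).smulRight y := by ext; simp
    rw [this, LinearMap.trace_smulRight]; rfl
  have h3 : ∑ u, A u * (χ.smulRight y * U) * A (-u) =
      (∑ u, A u * χ.smulRight y * A (g (-u))) * U := by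
    rw [Finset.sum_mul]
    refine Finset.sum_congr rfl fun u _ => ?_
    simp only [mul_assoc, hcomm]
  rw [h3, h2] at h1
  have hc : (Fintype.card W * χ (U y) / Module.finrank ℂ H : ℂ) ≠ 0 :=
    div_ne_zero (mul_ne_zero (Nat.cast_ne_zero.mpr Fintype.card_ne_zero) hχ) hd
  have hinj : Function.Injective U := by
    rw [injective_iff_map_eq_zero]
    intro z hz
    have := congrArg (fun T : Module.End ℂ H => T z) h1
    simp only [Module.End.mul_apply, hz, _root_.map_zero, LinearMap.smul_apply,
      Module.End.one_apply] at this
    exact (smul_eq_zero.mp this.symm).resolve_left hc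
  exact ⟨LinearEquiv.ofInjectiveEndo U hinj, hcomm⟩

end IsHeisenbergSystem

/-! ### Trivializing the cocycle of a projective representation -/

section Coboundary

variable {H : Type*} [AddCommGroup H] [Module ℂ H] [FiniteDimensional ℂ H]

lemma det_smul_idempotent_add {P : Module.End ℂ H} (hP : IsIdempotentElem P) (c : ℂ) {m : ℕ}
    (hm : LinearMap.trace ℂ H P = m) : LinearMap.det (c • P + (1 - P)) = c ^ m := by
  have hp : LinearMap.IsProj (LinearMap.range P) P :=
    (LinearMap.isProj_range_iff_isIdempotentElem P).mpr hP
  have hm' : Module.finrank ℂ (LinearMap.range P) = m := by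
    rw [hp.trace] at hm
    exact_mod_cast hm
  set e := Submodule.prodEquivOfIsCompl _ _ hp.isCompl
  have h1 : c • P + (1 - P) = e.conj (LinearMap.prodMap (c • LinearMap.id) LinearMap.id) := by
    have h2 : (LinearMap.prodMap (c • LinearMap.id) LinearMap.id :
        Module.End ℂ (LinearMap.range P × LinearMap.ker P)) =
        c • LinearMap.prodMap LinearMap.id 0 + (LinearMap.id - LinearMap.prodMap LinearMap.id 0) := by
      ext <;> simp
    rw [h2, map_add, map_smul, map_sub, LinearEquiv.conj_id, ← hp.eq_conj_prodMap]
    rfl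
  rw [h1, LinearEquiv.conj_apply, LinearMap.comp_assoc, LinearMap.det_conj, LinearMap.det_prodMap, LinearMap.det_smul,
    LinearMap.det_id, LinearMap.det_id, hm', mul_one, mul_one]

lemma exists_trace_eq_natCast {P : Module.End ℂ H} (hP : IsIdempotentElem P) :
    ∃ m : ℕ, LinearMap.trace ℂ H P = m :=
  ⟨_, ((LinearMap.isProj_range_iff_isIdempotentElem P).mpr hP).trace⟩

/-- `P * U + (1 - P)` is `U` on the range of `P` and the identity on its kernel, so its determinant
is that of the restriction of `U` to the range. -/
lemma idempotent_mul_add_mul {R : Type*} [Ring R] {P U V : R} (hP : IsIdempotentElem P)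
    (hU : P * U = U * P) :
    (P * U + (1 - P)) * (P * V + (1 - P)) = P * (U * V) + (1 - P) := by
  have h1 : (1 - P) * P = 0 := by rw [sub_mul, one_mul, hP.eq, sub_self]
  have h2 : (1 - P) * (1 - P) = 1 - P := hP.one_sub.eq
  have h3 : P * U * P = P * U := by rw [mul_assoc, ← hU, ← mul_assoc, hP.eq]
  have h4 : P * U * (1 - P) = 0 := by rw [mul_sub, mul_one, h3, sub_self]
  rw [add_mul, mul_add, mul_add, h4, h2, ← mul_assoc, h3, ← mul_assoc (1 - P), h1, zero_mul]
  simp [mul_assoc]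

/-- A projective representation commuting with an idempotent of rank `m` has a cocycle whose
`m`-th power is a coboundary. -/
lemma exists_pow_coboundary {G : Type*} [Group G] {P : Module.End ℂ H} (hP : IsIdempotentElem P)
    {m : ℕ} (hm : LinearMap.trace ℂ H P = m) (U : G → (H ≃ₗ[ℂ] H)) (c : G → G → ℂˣ)
    (hU : ∀ g, P * (U g).toLinearMap = (U g).toLinearMap * P)
    (hc : ∀ g h, (U g).toLinearMap * (U h).toLinearMap =
      (c g h : ℂ) • (U (g * h)).toLinearMap) :
    ∃ x : G → ℂˣ, ∀ g h, x g * x h = c g h ^ m * x (g * h) := by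
  have hone : ∀ g, (U g).toLinearMap * (U g).symm.toLinearMap = 1 := fun g => by ext; simp
  have hne : ∀ g, LinearMap.det (P * (U g).toLinearMap + (1 - P)) ≠ 0 := fun g => by
    have h1 := idempotent_mul_add_mul (V := (U g).symm.toLinearMap) hP (hU g)
    rw [hone, mul_one, add_sub_cancel] at h1
    have h2 := congrArg LinearMap.det h1
    rw [map_mul, map_one] at h2
    exact left_ne_zero_of_mul_eq_one h2
  refine ⟨fun g => Units.mk0 _ (hne g), fun g h => Units.ext ?_⟩
  have h1 := idempotent_mul_add_mul (V := (U h).toLinearMap) hP (hU g)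
  have h2 : P * ((c g h : ℂ) • (U (g * h)).toLinearMap) + (1 - P) =
      ((c g h : ℂ) • P + (1 - P)) * (P * (U (g * h)).toLinearMap + (1 - P)) := by
    have := idempotent_mul_add_mul (U := (c g h : ℂ) • (1 : Module.End ℂ H))
      (V := (U (g * h)).toLinearMap) hP (by simp)
    rw [mul_smul_comm, mul_one, smul_mul_assoc, one_mul] at this
    exact this.symm
  rw [hc, h2] at h1
  have h3 := congrArg LinearMap.det h1
  rw [map_mul, map_mul, det_smul_idempotent_add hP _ hm] at h3
  simpa using h3

/-- If a projective representation commutes with an involution of trace `1`, then its cocycle is a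
coboundary: compare the determinants on the two eigenspaces of the involution. -/
lemma exists_coboundary_of_involution {G : Type*} [Group G] {J : Module.End ℂ H}
    (hJ : J * J = 1) (htr : LinearMap.trace ℂ H J = 1) (U : G → (H ≃ₗ[ℂ] H)) (c : G → G → ℂˣ)
    (hU : ∀ g, J * (U g).toLinearMap = (U g).toLinearMap * J)
    (hc : ∀ g h, (U g).toLinearMap * (U h).toLinearMap =
      (c g h : ℂ) • (U (g * h)).toLinearMap) :
    ∃ x : G → ℂˣ, ∀ g h, c g h = x h * (x (g * h))⁻¹ * x g := by
  -- The projector onto the +1 eigenspace of `J`.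
  set P : Module.End ℂ H := (2⁻¹ : ℂ) • (1 + J) with hPdef
  have hP : IsIdempotentElem P := by
    rw [IsIdempotentElem, hPdef, smul_mul_smul_comm, add_mul, one_mul, mul_add, hJ, mul_one,
      add_comm J 1, ← two_smul ℂ (1 + J), smul_smul]
    norm_num
  have hPU : ∀ g, P * (U g).toLinearMap = (U g).toLinearMap * P := fun g => by
    rw [hPdef, smul_mul_assoc, mul_smul_comm, add_mul, mul_add, hU, one_mul, mul_one]
  have hQU : ∀ g, (1 - P) * (U g).toLinearMap = (U g).toLinearMap * (1 - P) := fun g => by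
    rw [sub_mul, mul_sub, hPU, one_mul, mul_one]
  obtain ⟨a, ha⟩ := exists_trace_eq_natCast hP
  obtain ⟨b, hb⟩ := exists_trace_eq_natCast hP.one_sub
  have hab : a = b + 1 := by
    have h1 : P - (1 - P) = J := by
      have : P + P = 1 + J := by rw [hPdef, ← two_smul ℂ, smul_smul]; norm_num
      rw [sub_sub_eq_add_sub, this, add_sub_cancel_left]
    have h2 := congrArg (LinearMap.trace ℂ H) h1
    rw [map_sub, ha, hb, htr, sub_eq_iff_eq_add, add_comm] at h2
    exact_mod_cast h2
  obtain ⟨x, hx⟩ := exists_pow_coboundary hP ha U c hPU hc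
  obtain ⟨y, hy⟩ := exists_pow_coboundary hP.one_sub hb U c hQU hc
  -- The ranks satisfy a = b + 1, so c = c^a / c^b.
  refine ⟨fun g => x g * (y g)⁻¹, fun g h => ?_⟩
  have h1 := hx g h
  have h2 := hy g h
  rw [hab, pow_succ'] at h1
  have h3 : c g h * x (g * h) * (y g * y h) = x g * x h * y (g * h) := by
    rw [h1, h2]
    simp only [mul_comm, mul_left_comm, mul_assoc]
  have h4 : c g h = x g * x h * y (g * h) * (y g * y h)⁻¹ * (x (g * h))⁻¹ := by
    rw [← h3, mul_inv_cancel_right, mul_inv_cancel_right]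
  rw [h4]
  apply Additive.ofMul.injective
  simp only [ofMul_mul, ofMul_inv]
  abel

end Coboundary

/-- The cocycle of a projective representation that permutes the operators of a Heisenberg system
by automorphisms of the index group is a coboundary. -/
lemma IsHeisenbergSystem.exists_coboundary {W H G : Type*} [AddCommGroup W] [Fintype W]
    [AddCommGroup H] [Module ℂ H] [FiniteDimensional ℂ H] [Nontrivial H] [Group G]
    {B : W → W → ℂ} {A : W → Module.End ℂ H} (h : IsHeisenbergSystem B A)
    (s : G → W ≃+ W) (U : G → (H ≃ₗ[ℂ] H)) (c : G → G → ℂˣ)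
    (hU : ∀ g u, A (s g u) * (U g).toLinearMap = (U g).toLinearMap * A u)
    (hc : ∀ g h, (U g).toLinearMap * (U h).toLinearMap =
      (c g h : ℂ) • (U (g * h)).toLinearMap) :
    ∃ x : G → ℂˣ, ∀ g h, c g h = x h * (x (g * h))⁻¹ * x g := by
  have hd : (Module.finrank ℂ H : ℂ) ≠ 0 := Nat.cast_ne_zero.mpr Module.finrank_pos.ne'
  refine exists_coboundary_of_involution (J := (Module.finrank ℂ H : ℂ)⁻¹ • ∑ u, A u)
    ?_ ?_ U c (fun g => ?_) hc
  · rw [smul_mul_smul_comm, h.sum_mul_sum, ← h.finrank_sq, smul_smul, sq]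
    field_simp
    rw [one_smul]
  · rw [map_smul, h.trace_sum, smul_eq_mul, inv_mul_cancel₀ hd]
  · rw [smul_mul_assoc, mul_smul_comm, Finset.sum_mul, Finset.mul_sum,
      ← Equiv.sum_comp (s g).toEquiv]
    congr 1
    exact Finset.sum_congr rfl fun u _ => hU g u

/-! ### Irreducible representations of finite groups -/

namespace Representation

section Irreducible

variable {K V : Type*} [Group K] [AddCommGroup V] [Module ℂ V] {π : Representation ℂ K V}

lemma IsIrreducible.eq_bot_or_eq_top_of_invariant (hπ : π.IsIrreducible) (N : Submodule ℂ V)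
    (hN : ∀ k, ∀ v ∈ N, π k v ∈ N) : N = ⊥ ∨ N = ⊤ := by
  rcases hπ.eq_bot_or_eq_top (⟨N, hN⟩ : Subrepresentation π) with h | h
  · exact Or.inl (congrArg Subrepresentation.toSubmodule h)
  · exact Or.inr (congrArg Subrepresentation.toSubmodule h)

lemma isIrreducible_of_forall_invariant [Nontrivial V]
    (h : ∀ N : Submodule ℂ V, (∀ k, ∀ v ∈ N, π k v ∈ N) → N = ⊥ ∨ N = ⊤) : π.IsIrreducible where
  exists_pair_ne := ⟨⊥, ⊤, fun h =>
    bot_ne_top (congrArg Subrepresentation.toSubmodule h : (⊥ : Submodule ℂ V) = ⊤)⟩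
  eq_bot_or_eq_top N := (h N.toSubmodule fun k _ hv => N.apply_mem_toSubmodule k hv).imp
    (fun h => Subrepresentation.toSubmodule_injective h)
    (fun h => Subrepresentation.toSubmodule_injective h)

lemma IsIrreducible.nontrivial_space (hπ : π.IsIrreducible) : Nontrivial V := by
  by_contra h
  rw [not_nontrivial_iff_subsingleton] at h
  obtain ⟨M, N, hMN⟩ := hπ.exists_pair_ne
  exact hMN (Subrepresentation.toSubmodule_injective (Subsingleton.elim _ _))

lemma IsIrreducible.finiteDimensional_space [Finite K] (hπ : π.IsIrreducible) :
    FiniteDimensional ℂ V := by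
  have := hπ.nontrivial_space
  obtain ⟨v, hv⟩ := exists_ne (0 : V)
  have h := hπ.eq_bot_or_eq_top_of_invariant (Submodule.span ℂ (Set.range fun k => π k v))
    fun k w hw => by
      induction hw using Submodule.span_induction with
      | mem x hx =>
        obtain ⟨k', rfl⟩ := hx
        refine Submodule.subset_span ⟨k * k', ?_⟩
        simp [map_mul]
      | zero => simp
      | add x y _ _ hx hy => rw [map_add]; exact add_mem hx hy
      | smul a x _ hx => rw [map_smul]; exact Submodule.smul_mem _ _ hx
  rcases h with h | h
  · have h1 : v ∈ Submodule.span ℂ (Set.range fun k => π k v) :=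
      Submodule.subset_span ⟨1, by simp⟩
    rw [h, Submodule.mem_bot] at h1
    exact absurd h1 hv
  · exact .of_fg_top (h ▸ Submodule.fg_span (Set.finite_range _))

lemma IsIrreducible.exists_eq_smul_one_of_commute [Finite K] (hπ : π.IsIrreducible)
    {T : Module.End ℂ V} (hT : ∀ k, T * π k = π k * T) : ∃ c : ℂ, T = c • 1 := by
  have := hπ.nontrivial_space
  have := hπ.finiteDimensional_space
  obtain ⟨c, hc⟩ := Module.End.exists_eigenvalue T
  refine ⟨c, ?_⟩
  rcases hπ.eq_bot_or_eq_top_of_invariant (Module.End.eigenspace T c) fun k v hv => by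
    rw [Module.End.mem_eigenspace_iff] at hv ⊢
    rw [← Module.End.mul_apply, hT, Module.End.mul_apply, hv, map_smul] with h | h
  · exact absurd h hc
  · ext v
    have : v ∈ Module.End.eigenspace T c := h ▸ Submodule.mem_top
    simpa using Module.End.mem_eigenspace_iff.mp this

end Irreducible

/-- A linear character of a subgroup of a finite group is contained in an irreducible
representation. -/
lemma exists_isIrreducible_eigenvector {K S : Type*} [Group K] [Finite K] [Group S] (i : S →* K)
    (hi : Function.Injective i) (ψ : S →* ℂˣ) :
    ∃ (d : ℕ) (π : Representation ℂ K (Fin d → ℂ)), π.IsIrreducible ∧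
      ∃ v, v ≠ 0 ∧ ∀ s, π (i s) v = ((ψ s : ℂˣ) : ℂ) • v := by
  classical
  have : Finite S := Finite.of_injective i hi
  have := Fintype.ofFinite S
  let ρ : K → (K → ℂ) →ₗ[ℂ] (K → ℂ) := fun g => LinearMap.funLeft ℂ ℂ (· * g)
  -- The representation induced from ψ, realized on functions on K with K acting by right
  -- translation. A minimal nonzero invariant subspace of it is irreducible.
  let I : Submodule ℂ (K → ℂ) :=
    { carrier := {f | ∀ s k, f (i s * k) = (ψ s : ℂ) * f k}
      zero_mem' := by simp
      add_mem' := fun {f g} hf hg s k => by simp [hf s k, hg s k, mul_add]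
      smul_mem' := fun c f hf s k => by simp [hf s k, mul_left_comm] }
  let Good : Set (Submodule ℂ (K → ℂ)) := {N | N ≠ ⊥ ∧ N ≤ I ∧ ∀ g, ∀ f ∈ N, ρ g f ∈ N}
  have hGood : Good.Nonempty := by
    refine ⟨I, fun h0 => ?_, le_rfl, fun g f hf s k => ?_⟩
    · let f : K → ℂ := fun k => if h : ∃ s, i s = k then (ψ h.choose : ℂ) else 0
      have hf0 : ∀ s, f (i s) = ψ s := fun s => by
        have h : ∃ t, i t = i s := ⟨s, rfl⟩
        have h1 : h.choose = s := hi h.choose_spec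
        simp only [f, dif_pos h, h1]
      have hf : f ∈ I := fun s k => by
        by_cases h : ∃ t, i t = k
        · obtain ⟨t, rfl⟩ := h
          rw [← map_mul, hf0, hf0, map_mul, Units.val_mul]
        · have h' : ¬ ∃ t, i t = i s * k := by
            rintro ⟨t, ht⟩
            exact h ⟨s⁻¹ * t, by rw [map_mul, ht, map_inv, inv_mul_cancel_left]⟩
          simp only [f, dif_neg h, dif_neg h', mul_zero]
      rw [h0, Submodule.mem_bot] at hf
      have := hf0 1
      rw [hf] at this
      simp at this
    · have := hf s (k * g)
      simpa [ρ, LinearMap.funLeft_apply, mul_assoc] using this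
  obtain ⟨N, ⟨hN0, hNI, hNρ⟩, hmin⟩ :=
    (wellFounded_lt (α := Submodule ℂ (K → ℂ))).has_min Good hGood
  let σ : Representation ℂ K N :=
    { toFun := fun g => (ρ g).restrict (hNρ g)
      map_one' := by ext f k; simp [ρ, LinearMap.funLeft_apply]
      map_mul' := fun g h => by ext f k; simp [ρ, LinearMap.funLeft_apply, mul_assoc] }
  have : Nontrivial N := Submodule.nontrivial_iff_ne_bot.mpr hN0
  have hσ : ∀ M : Submodule ℂ N, (∀ k, ∀ v ∈ M, σ k v ∈ M) → M = ⊥ ∨ M = ⊤ := fun M hM => by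
    by_contra! h
    have hne : M.map N.subtype ≠ ⊥ := fun h0 =>
      h.1 (Submodule.map_injective_of_injective N.injective_subtype (by rw [h0, Submodule.map_bot]))
    have hle : M.map N.subtype ≤ N := Submodule.map_subtype_le N M
    refine hmin (M.map N.subtype) ⟨hne, hle.trans hNI, ?_⟩ (lt_of_le_of_ne hle fun he => ?_)
    · rintro g _ ⟨f, hf, rfl⟩
      exact ⟨σ g f, hM g f hf, rfl⟩
    · apply h.2
      rw [eq_top_iff]
      rintro ⟨f, hf⟩ -
      have h1 := hf
      rw [← he] at h1
      obtain ⟨f', hf', rfl⟩ := h1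
      exact hf'
  -- Coordinates move the space into `Type`, the universe required by `IsSchurMultiplier`.
  let e := (Module.finBasis ℂ N).equivFun
  let π : Representation ℂ K (Fin (Module.finrank ℂ N) → ℂ) :=
    { toFun := fun g => e.conj (σ g)
      map_one' := by rw [map_one]; exact e.conj_id
      map_mul' := fun g h => by rw [map_mul]; exact e.conj_comp _ _ }
  have : Nontrivial (Fin (Module.finrank ℂ N) → ℂ) := e.symm.toEquiv.nontrivial
  refine ⟨_, π, isIrreducible_of_forall_invariant fun M hM => ?_, ?_⟩
  · have h1 := hσ (M.comap e.toLinearMap) fun k f hf => by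
      have := hM k _ hf
      simpa [π] using this
    rcases h1 with h1 | h1
    · left
      rw [eq_bot_iff]
      intro x hx
      have h2 : e.symm x ∈ M.comap e.toLinearMap := by simpa using hx
      rw [h1, Submodule.mem_bot] at h2
      simpa using h2
    · right
      rw [eq_top_iff]
      intro x _
      have h2 : e.symm x ∈ M.comap e.toLinearMap := h1 ▸ Submodule.mem_top
      simpa using h2
  · obtain ⟨f, hf, hf0⟩ := N.ne_bot_iff.mp hN0
    obtain ⟨k, hk⟩ := Function.ne_iff.mp hf0
    -- Translating makes the function nonzero at 1; its ψ-isotypic projection `w` then has value |S|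
    -- f'(1) ≠ 0 there.
    set f' : N := σ k ⟨f, hf⟩ with hf'
    have hf1 : f'.1 1 ≠ 0 := by
      simpa [hf', σ, ρ, LinearMap.funLeft_apply] using hk
    have hf2 : ∀ s, f'.1 (i s) = (ψ s : ℂ) * f'.1 1 := fun s => by
      have := hNI f'.2 s 1
      rwa [mul_one] at this
    set w : N := ∑ s, (((ψ s)⁻¹ : ℂˣ) : ℂ) • σ (i s) f' with hw
    have hw0 : w ≠ 0 := fun h0 => by
      have h1 : w.1 1 = Fintype.card S * f'.1 1 := by
        rw [hw]
        simp only [Submodule.coe_sum, Submodule.coe_smul, Finset.sum_apply, Pi.smul_apply]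
        have : ∀ s, (((ψ s)⁻¹ : ℂˣ) : ℂ) • (σ (i s) f').1 1 = f'.1 1 := fun s => by
          have h2 : (σ (i s) f').1 1 = f'.1 (i s) := by
            simp [σ, ρ, LinearMap.funLeft_apply]
          rw [h2, hf2, smul_eq_mul, ← mul_assoc, Units.inv_mul, one_mul]
        rw [Finset.sum_congr rfl fun s _ => this s, Finset.sum_const, Finset.card_univ, nsmul_eq_mul]
      rw [h0] at h1
      have h3 : (Fintype.card S : ℂ) ≠ 0 := Nat.cast_ne_zero.mpr Fintype.card_ne_zero
      exact mul_ne_zero h3 hf1 h1.symm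
    have hwψ : ∀ s, σ (i s) w = (ψ s : ℂ) • w := fun s => by
      rw [hw, map_sum, Finset.smul_sum, ← Equiv.sum_comp (Equiv.mulLeft s)
        (fun t => (ψ s : ℂ) • (((ψ t)⁻¹ : ℂˣ) : ℂ) • σ (i t) f')]
      refine Finset.sum_congr rfl fun t _ => ?_
      simp only [Equiv.coe_mulLeft, map_mul, map_smul, smul_smul, mul_inv, Units.val_mul,
        Module.End.mul_apply, Units.mul_inv_cancel_left]
    exact ⟨e w, by simpa using hw0, fun s => by simp [π, hwψ]⟩

end Representation

/-! ### The adjoint action of a matrix with separable characteristic polynomial -/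

section Adjoint

variable {k : Type*} [Field k] {n : ℕ}

/-- The linear map `X ↦ b X - X b`. -/
def adMatrix (b : Matrix (Fin n) (Fin n) k) :
    Matrix (Fin n) (Fin n) k →ₗ[k] Matrix (Fin n) (Fin n) k :=
  LinearMap.mulLeft k b - LinearMap.mulRight k b

@[simp] lemma adMatrix_apply (b X : Matrix (Fin n) (Fin n) k) :
    adMatrix b X = b * X - X * b := rfl

lemma mem_ker_adMatrix {b X : Matrix (Fin n) (Fin n) k} :
    X ∈ LinearMap.ker (adMatrix b) ↔ b * X = X * b := by
  rw [LinearMap.mem_ker, adMatrix_apply, sub_eq_zero]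

/-- If `[b, X] = Y` commutes with `b`, then `[f(b), X] = f'(b) Y` for every polynomial `f`. -/
lemma aeval_mul_sub_mul_aeval {b X Y : Matrix (Fin n) (Fin n) k} (hX : b * X - X * b = Y)
    (hY : b * Y = Y * b) (f : Polynomial k) :
    Polynomial.aeval b f * X - X * Polynomial.aeval b f =
      Polynomial.aeval b (Polynomial.derivative f) * Y := by
  induction f using Polynomial.induction_on with
  | C a => simp [Algebra.algebraMap_eq_smul_one]
  | add p q hp hq =>
    rw [map_add, Polynomial.derivative_add, map_add, add_mul, mul_add, add_mul, ← hp, ← hq]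
    abel
  | monomial m a hm =>
    rw [pow_succ, ← mul_assoc]
    generalize Polynomial.C a * Polynomial.X ^ m = p at hm ⊢
    rw [map_mul, Polynomial.aeval_X, Polynomial.derivative_mul, map_add,
      Polynomial.derivative_X, mul_one, map_mul, Polynomial.aeval_X, add_mul, mul_assoc _ b Y, hY,
      ← mul_assoc _ Y b, ← hm, ← hX]
    noncomm_ring

/-- If Y = [b, X] commutes with b and f is the characteristic polynomial, then f'(b) Y = [f(b), X] =
0 by Cayley–Hamilton, and f'(b) is invertible because f and f' are coprime. -/
lemma disjoint_range_ker_adMatrix {b : Matrix (Fin n) (Fin n) k} (hb : b.charpoly.Separable) :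
    Disjoint (LinearMap.range (adMatrix b)) (LinearMap.ker (adMatrix b)) := by
  rw [Submodule.disjoint_def]
  rintro _ ⟨X, rfl⟩ hY
  rw [mem_ker_adMatrix] at hY
  have h1 := aeval_mul_sub_mul_aeval (adMatrix_apply b X).symm hY b.charpoly
  rw [Matrix.aeval_self_charpoly, zero_mul, mul_zero, sub_zero] at h1
  obtain ⟨p, q, hpq⟩ := hb
  have h2 := congrArg (Polynomial.aeval b) hpq
  rw [map_add, map_mul, map_mul, Matrix.aeval_self_charpoly, mul_zero, zero_add, map_one] at h2
  rw [← one_mul (adMatrix b X), ← h2, mul_assoc, ← h1, mul_zero]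

lemma exists_range_add_ker_adMatrix {b : Matrix (Fin n) (Fin n) k} (hb : b.charpoly.Separable)
    (X : Matrix (Fin n) (Fin n) k) : ∃ w ∈ LinearMap.range (adMatrix b),
      ∃ z ∈ LinearMap.ker (adMatrix b), w + z = X := by
  have h : IsCompl (LinearMap.range (adMatrix b)) (LinearMap.ker (adMatrix b)) :=
    (Submodule.isCompl_iff_disjoint _ _
      (LinearMap.finrank_range_add_finrank_ker (adMatrix b)).ge).mpr
      (disjoint_range_ker_adMatrix hb)
  exact Submodule.mem_sup.mp (h.sup_eq_top ▸ Submodule.mem_top)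

/-- This form of the pairing shows its radical: Y pairs trivially with every X as soon as Y commutes
with b. -/
lemma trace_commutator_mul (b X Y : Matrix (Fin n) (Fin n) k) :
    ((X * Y - Y * X) * b).trace = (X * (Y * b - b * Y)).trace := by
  rw [sub_mul, mul_sub, Matrix.trace_sub, Matrix.trace_sub, mul_assoc, mul_assoc Y,
    Matrix.trace_mul_comm Y, mul_assoc]

end Adjoint

/-- A family of operators indexed by `M_n(k)`, multiplicative up to the multiplier
`θ (t tr ([X, Y] b))`, whose commutant consists of scalars. -/
structure IsMatrixHeisenberg {k H : Type*} [Field k] {n : ℕ} [AddCommGroup H] [Module ℂ H]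
    (b : Matrix (Fin n) (Fin n) k) (θ : AddChar k ℂ) (t : k)
    (A : Matrix (Fin n) (Fin n) k → Module.End ℂ H) : Prop where
  map_zero : A 0 = 1
  map_mul : ∀ X Y, A X * A Y = θ (t * ((X * Y - Y * X) * b).trace) • A (X + Y)
  commutant : ∀ T : Module.End ℂ H, (∀ X, T * A X = A X * T) → ∃ c : ℂ, T = c • 1

namespace IsMatrixHeisenberg

variable {k H : Type*} [Field k] {n : ℕ} [AddCommGroup H] [Module ℂ H]
  {b : Matrix (Fin n) (Fin n) k} {θ : AddChar k ℂ} {t : k}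
  {A : Matrix (Fin n) (Fin n) k → Module.End ℂ H}

lemma map_add_of_commute (h : IsMatrixHeisenberg b θ t A) (X : Matrix (Fin n) (Fin n) k)
    {Z : Matrix (Fin n) (Fin n) k} (hZ : b * Z = Z * b) : A (X + Z) = A X * A Z := by
  rw [h.map_mul, trace_commutator_mul, hZ, sub_self, mul_zero, Matrix.trace_zero, mul_zero,
    AddChar.map_zero_eq_one, one_smul]

lemma map_add_of_commute' (h : IsMatrixHeisenberg b θ t A) (X : Matrix (Fin n) (Fin n) k)
    {Z : Matrix (Fin n) (Fin n) k} (hZ : b * Z = Z * b) : A (X + Z) = A Z * A X := by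
  rw [h.map_mul, ← neg_sub, neg_mul, Matrix.trace_neg, trace_commutator_mul, hZ, sub_self,
    mul_zero, Matrix.trace_zero, neg_zero, mul_zero, AddChar.map_zero_eq_one, one_smul, add_comm]

lemma exists_eq_smul_one (h : IsMatrixHeisenberg b θ t A)
    {Z : Matrix (Fin n) (Fin n) k} (hZ : b * Z = Z * b) : ∃ c : ℂ, A Z = c • 1 :=
  h.commutant _ fun X => by rw [← h.map_add_of_commute X hZ, ← h.map_add_of_commute' X hZ]

/-- On the centralizer, which complements the range of ad b, the operators are scalar; restricting
to the range therefore removes the radical without enlarging the commutant. -/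
lemma isHeisenbergSystem (h : IsMatrixHeisenberg b θ t A) (hb : b.charpoly.Separable)
    (ht : 2 * t = 1) (hθ : ∃ c, θ c ≠ 1) :
    IsHeisenbergSystem (W := LinearMap.range (adMatrix b))
      (fun u v => θ (t * ((u.1 * v.1 - v.1 * u.1) * b).trace)) (fun u => A u.1) where
  add_left u v w := by
    rw [← AddChar.map_add_eq_mul, ← mul_add, ← Matrix.trace_add, ← add_mul]
    congr 4
    rw [Submodule.coe_add]
    noncomm_ring
  skew u v := by
    rw [← AddChar.map_add_eq_mul, ← mul_add, ← Matrix.trace_add, ← add_mul]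
    simp
  self u := by simp
  nondegenerate u hu := by
    by_contra! h0
    have h1 : ∀ X, θ ((X * (u.1 * b - b * u.1)).trace) = 1 := fun X => by
      obtain ⟨w, hw, z, hz, rfl⟩ := exists_range_add_ker_adMatrix hb X
      rw [mem_ker_adMatrix] at hz
      have h2 := h0 ⟨w, hw⟩
      -- Squaring the multiplier cancels the factor `t`, which is 1/2.
      rw [← AddChar.map_nsmul_eq_pow, nsmul_eq_mul, Nat.cast_ofNat, ← mul_assoc, ht, one_mul,
        trace_commutator_mul] at h2
      have h3 : (z * (u.1 * b - b * u.1)).trace = 0 := by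
        rw [← trace_commutator_mul, ← neg_sub, neg_mul, Matrix.trace_neg, trace_commutator_mul, hz,
          sub_self, mul_zero, Matrix.trace_zero, neg_zero]
      rw [add_mul, Matrix.trace_add, h3, add_zero, h2]
    have h2 : u.1 * b - b * u.1 = 0 := by
      ext i j
      by_contra hij
      obtain ⟨c, hc⟩ := hθ
      apply hc
      -- A scaled matrix unit isolates the entry (i, j) and gives the trace the value c.
      have := h1 (Matrix.single j i (c * ((u.1 * b - b * u.1) i j)⁻¹))
      rwa [Matrix.trace_single_mul, smul_eq_mul, mul_assoc, inv_mul_cancel₀ hij, mul_one] at this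
    exact hu (Subtype.ext (Submodule.disjoint_def.mp (disjoint_range_ker_adMatrix hb) u.1 u.2
      (mem_ker_adMatrix.mpr (sub_eq_zero.mp h2).symm)))
  map_zero := h.map_zero
  map_mul u v := h.map_mul u v
  commutant T hT := h.commutant T fun X => by
    obtain ⟨w, hw, z, hz, rfl⟩ := exists_range_add_ker_adMatrix hb X
    obtain ⟨c, hc⟩ := h.exists_eq_smul_one (mem_ker_adMatrix.mp hz)
    rw [h.map_add_of_commute w (mem_ker_adMatrix.mp hz), hc, mul_smul_comm, mul_smul_comm,
      smul_mul_assoc, mul_one, hT ⟨w, hw⟩]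

/-- Conjugation by a unit commuting with `b`, as an automorphism of the image of `ad b`. -/
def conjRange {e e' : Matrix (Fin n) (Fin n) k} (h1 : e * e' = 1) (h2 : e' * e = 1)
    (h3 : b * e = e * b) (h4 : b * e' = e' * b) :
    LinearMap.range (adMatrix b) ≃+ LinearMap.range (adMatrix b) where
  toFun w := ⟨e * w * e', by
    obtain ⟨_, X, rfl⟩ := w
    refine ⟨e * X * e', ?_⟩
    simp only [adMatrix_apply, mul_sub, sub_mul, mul_assoc, ← h4]
    simp only [← mul_assoc, h3]⟩
  invFun w := ⟨e' * w * e, by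
    obtain ⟨_, X, rfl⟩ := w
    refine ⟨e' * X * e, ?_⟩
    simp only [adMatrix_apply, mul_sub, sub_mul, mul_assoc, ← h3]
    simp only [← mul_assoc, h4]⟩
  left_inv w := Subtype.ext (by
    simp only [mul_assoc, h2, mul_one]
    rw [← mul_assoc, h2, one_mul])
  right_inv w := Subtype.ext (by
    simp only [mul_assoc, h1, mul_one]
    rw [← mul_assoc, h1, one_mul])
  map_add' u v := Subtype.ext (by simp [mul_add, add_mul])

/-- Because e commutes with the whole centralizer of b, conjugation fixes the centralizer component
of X, where A is scalar; the intertwiner found on the range of ad b thus serves all X. -/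
lemma exists_intertwiner [Finite k] [FiniteDimensional ℂ H] [Nontrivial H]
    (h : IsMatrixHeisenberg b θ t A) (hb : b.charpoly.Separable)
    (ht : 2 * t = 1) (hθ : ∃ c, θ c ≠ 1) {e e' : Matrix (Fin n) (Fin n) k} (h1 : e * e' = 1)
    (h2 : e' * e = 1) (h3 : ∀ Z, b * Z = Z * b → e * Z = Z * e) :
    ∃ U : H ≃ₗ[ℂ] H, ∀ X, A (e * X * e') * U.toLinearMap = U.toLinearMap * A X := by
  have := Fintype.ofFinite (LinearMap.range (adMatrix b))
  have h4 : b * e' = e' * b := by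
    rw [← one_mul (b * e'), ← h2, mul_assoc, ← mul_assoc e, h3 b rfl, mul_assoc b, h1, mul_one]
  have h3' := (h3 b rfl).symm
  obtain ⟨U, hU⟩ := (h.isHeisenbergSystem hb ht hθ).exists_intertwiner (conjRange h1 h2 h3' h4)
    fun u v => by
      have h5 : ∀ x y : Matrix (Fin n) (Fin n) k, e * x * e' * (e * y * e') = e * (x * y) * e' :=
        fun x y => by
          rw [mul_assoc (e * x), mul_assoc e y, ← mul_assoc e' e, h2, one_mul]
          simp only [mul_assoc]
      simp only [conjRange, AddEquiv.coe_mk, Equiv.coe_fn_mk]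
      rw [h5, h5, ← sub_mul, ← mul_sub, Matrix.trace_mul_comm, ← mul_assoc, ← mul_assoc, h3',
        Matrix.trace_mul_comm, ← mul_assoc, ← mul_assoc, h2, one_mul,
        Matrix.trace_mul_comm]
  refine ⟨U, fun X => ?_⟩
  obtain ⟨w, hw, z, hz, rfl⟩ := exists_range_add_ker_adMatrix hb X
  rw [mem_ker_adMatrix] at hz
  have h5 : e * z * e' = z := by rw [h3 z hz, mul_assoc, h1, mul_one]
  obtain ⟨c, hc⟩ := h.exists_eq_smul_one hz
  rw [mul_add, add_mul, h5, h.map_add_of_commute _ hz, h.map_add_of_commute _ hz, hc, mul_smul_comm,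
    mul_smul_comm, mul_smul_comm, smul_mul_assoc, mul_one, mul_one, ← hU ⟨w, hw⟩]
  rfl

lemma exists_coboundary [Finite k] [FiniteDimensional ℂ H] [Nontrivial H]
    {G : Type*} [Group G] (h : IsMatrixHeisenberg b θ t A) (hb : b.charpoly.Separable)
    (ht : 2 * t = 1) (hθ : ∃ c, θ c ≠ 1) (s : G → Matrix (Fin n) (Fin n) k)
    (s' : G → Matrix (Fin n) (Fin n) k)
    (h1 : ∀ g, s g * s' g = 1) (h2 : ∀ g, s' g * s g = 1)
    (h3 : ∀ g, b * s g = s g * b) (h4 : ∀ g, b * s' g = s' g * b)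
    (U : G → (H ≃ₗ[ℂ] H)) (c : G → G → ℂˣ)
    (hU : ∀ g X, A (s g * X * s' g) * (U g).toLinearMap = (U g).toLinearMap * A X)
    (hc : ∀ g h, (U g).toLinearMap * (U h).toLinearMap =
      (c g h : ℂ) • (U (g * h)).toLinearMap) :
    ∃ x : G → ℂˣ, ∀ g h, c g h = x h * (x (g * h))⁻¹ * x g := by
  have := Fintype.ofFinite (LinearMap.range (adMatrix b))
  exact (h.isHeisenbergSystem hb ht hθ).exists_coboundary
    (fun g => conjRange (h1 g) (h2 g) (h3 g) (h4 g)) U c (fun g u => hU g u) hc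

end IsMatrixHeisenberg

/-! ### Truncated exponentials -/

section TruncExp

variable {S R : Type*} [CommRing S] [Ring R] [Algebra S R]

/-- The truncated exponential `1 + a x + t a² x²`, where `t` is to be `1 / 2`. -/
def truncExp (a t : S) (x : R) : R := 1 + a • x + (t * a ^ 2) • (x * x)

lemma truncExp_zero (a t : S) : truncExp a t (0 : R) = 1 := by simp [truncExp]

/-- The Baker–Campbell–Hausdorff formula, where a³ = 0 kills everything beyond the first commutator.
-/
lemma truncExp_mul {a t : S} (ha : a ^ 3 = 0) (ht : 2 * t = 1) (x y : R) :
    truncExp a t x * truncExp a t y =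
      truncExp a t (x + y) * (1 + (t * a ^ 2) • (x * y - y * x)) := by
  simp only [truncExp, mul_add, add_mul, mul_one, one_mul, smul_mul_assoc, mul_smul_comm, mul_sub,
    ← mul_assoc, smul_add, smul_sub, smul_smul]
  have h1 : a * t * a ^ 2 = 0 := by linear_combination t * ha
  have h2 : t * a ^ 2 * a = 0 := by linear_combination t * ha
  have h3 : t * a ^ 2 * t * a ^ 2 = 0 := by linear_combination t ^ 2 * a * ha
  have h4 : a * a = t * a ^ 2 + t * a ^ 2 := by linear_combination (-(a ^ 2) * ht)
  simp only [h1, h2, h3, h4, zero_smul, add_smul]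
  abel

lemma truncExp_add_smul {a t p : S} (hap : a ^ 2 * p = 0) (x z : R) :
    truncExp a t (x + p • z) = truncExp a t x * (1 + (a * p) • z) := by
  simp only [truncExp, mul_add, add_mul, mul_one, one_mul, smul_mul_assoc, mul_smul_comm,
    ← mul_assoc, smul_add, smul_smul]
  have h1 : t * a ^ 2 * p = 0 := by linear_combination t * hap
  have h2 : a * p * a = 0 := by linear_combination hap
  have h3 : a * p * t * a ^ 2 = 0 := by linear_combination t * a * hap
  simp only [h1, h2, h3, zero_mul, zero_smul]
  abel

/-- The argument is the truncated logarithm of 1 + a y with one factor a removed. -/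
lemma truncExp_sub_smul {a t : S} (ha : a ^ 3 = 0) (y : R) :
    truncExp a t (y - (t * a) • (y * y)) = 1 + a • y := by
  simp only [truncExp, mul_sub, sub_mul, smul_mul_assoc, mul_smul_comm,
    ← mul_assoc, smul_sub, smul_smul]
  have h1 : t * a ^ 2 * t * a = 0 := by linear_combination t ^ 2 * ha
  have h2 : a * t * a = t * a ^ 2 := by ring
  simp only [h1, h2, zero_mul, zero_smul]
  abel

lemma conj_truncExp {a t : S} {u v : R} (huv : u * v = 1) (hvu : v * u = 1) (x : R) :
    u * truncExp a t x * v = truncExp a t (u * x * v) := by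
  have h : u * x * v * (u * x * v) = u * (x * x) * v := by
    rw [mul_assoc (u * x), mul_assoc u x v, ← mul_assoc v u, hvu, one_mul]
    simp only [mul_assoc]
  simp only [truncExp, mul_add, add_mul, mul_smul_comm, smul_mul_assoc, mul_one, huv, h]

end TruncExp

/-! ### Elements of the congruence subgroups -/

section CongruenceElements

variable {O : Type*} [CommRing O] [IsLocalRing O] {n : ℕ}

lemma redPow_add (r : ℕ) (X Y : Matrix (Fin n) (Fin n) O) :
    redPow r (X + Y) = redPow r X + redPow r Y := Matrix.map_add _ (map_add _) X Y

lemma redPow_mul (r : ℕ) (X Y : Matrix (Fin n) (Fin n) O) :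
    redPow r (X * Y) = redPow r X * redPow r Y := Matrix.map_mul

lemma redPow_one (r : ℕ) : redPow r (1 : Matrix (Fin n) (Fin n) O) = 1 :=
  Matrix.map_one _ (map_zero _) (map_one _)

lemma redPow_sub (r : ℕ) (X Y : Matrix (Fin n) (Fin n) O) :
    redPow r (X - Y) = redPow r X - redPow r Y := Matrix.map_sub _ (map_sub _) X Y

lemma redPow_smul (r : ℕ) (a : O) (X : Matrix (Fin n) (Fin n) O) :
    redPow r (a • X) = Ideal.Quotient.mk (IsLocalRing.maximalIdeal O ^ r) a • redPow r X := by
  ext i j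
  simp [redPow]

lemma redRes_add (X Y : Matrix (Fin n) (Fin n) O) :
    redRes (X + Y) = redRes X + redRes Y := Matrix.map_add _ (map_add _) X Y

lemma redRes_mul (X Y : Matrix (Fin n) (Fin n) O) :
    redRes (X * Y) = redRes X * redRes Y := Matrix.map_mul

lemma redRes_sub (X Y : Matrix (Fin n) (Fin n) O) :
    redRes (X - Y) = redRes X - redRes Y := Matrix.map_sub _ (map_sub _) X Y

lemma redRes_one : redRes (1 : Matrix (Fin n) (Fin n) O) = 1 :=
  Matrix.map_one _ (map_zero _) (map_one _)

lemma redRes_trace (X : Matrix (Fin n) (Fin n) O) :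
    (redRes X).trace = IsLocalRing.residue O X.trace := by
  simp [redRes, Matrix.trace, map_sum]

lemma redRes_smul (a : O) (X : Matrix (Fin n) (Fin n) O) :
    redRes (a • X) = IsLocalRing.residue O a • redRes X := by
  ext i j
  simp [redRes]

lemma redPow_surjective (r : ℕ) :
    Function.Surjective (redPow r : Matrix (Fin n) (Fin n) O → _) := fun Y => by
  choose f hf using fun a b => Ideal.Quotient.mk_surjective (Y a b)
  exact ⟨Matrix.of f, by ext a b; simp [hf]⟩

lemma redRes_surjective :
    Function.Surjective (redRes : Matrix (Fin n) (Fin n) O → _) := fun Y => by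
  choose f hf using fun a b => IsLocalRing.residue_surjective (Y a b)
  exact ⟨Matrix.of f, by ext a b; simp [hf]⟩

lemma redPow_truncExp (r : ℕ) (a t : O) (X : Matrix (Fin n) (Fin n) O) :
    redPow r (truncExp a t X) = truncExp (Ideal.Quotient.mk (IsLocalRing.maximalIdeal O ^ r) a)
      (Ideal.Quotient.mk (IsLocalRing.maximalIdeal O ^ r) t) (redPow r X) := by
  rw [truncExp, truncExp, redPow_add, redPow_add, redPow_one, redPow_smul, redPow_smul, redPow_mul,
    map_mul, map_pow]

variable {ϖ : O} (hm : IsLocalRing.maximalIdeal O = Ideal.span {ϖ})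

include hm

lemma mk_uniformizer_pow_eq_zero {r j : ℕ} (hj : r ≤ j) :
    Ideal.Quotient.mk (IsLocalRing.maximalIdeal O ^ r) (ϖ ^ j) = 0 := by
  rw [Ideal.Quotient.eq_zero_iff_mem, hm, Ideal.span_singleton_pow, Ideal.mem_span_singleton]
  exact pow_dvd_pow ϖ hj

lemma redPow_eq_iff {r : ℕ} {X Y : Matrix (Fin n) (Fin n) O} :
    redPow r X = redPow r Y ↔ ∃ Z, X = Y + ϖ ^ r • Z := by
  constructor
  · intro h
    have h1 : ∀ i j, ∃ z, X i j = Y i j + ϖ ^ r * z := fun i j => by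
      have h2 : redPow r X i j = redPow r Y i j := by rw [h]
      have h3 := Ideal.Quotient.eq.mp h2
      rw [hm, Ideal.span_singleton_pow, Ideal.mem_span_singleton] at h3
      obtain ⟨z, hz⟩ := h3
      exact ⟨z, by rw [← hz]; ring⟩
    choose Z hZ using h1
    exact ⟨Matrix.of Z, by ext i j; simp [hZ]⟩
  · rintro ⟨Z, rfl⟩
    rw [redPow_add, redPow_smul, mk_uniformizer_pow_eq_zero hm le_rfl, zero_smul, add_zero]

lemma residue_uniformizer : IsLocalRing.residue O ϖ = 0 := by
  rw [IsLocalRing.residue_eq_zero_iff, hm]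
  exact Ideal.mem_span_singleton_self ϖ

lemma redRes_eq_iff {X Y : Matrix (Fin n) (Fin n) O} :
    redRes X = redRes Y ↔ ∃ Z, X = Y + ϖ • Z := by
  constructor
  · intro h
    have h1 : ∀ i j, ∃ z, X i j = Y i j + ϖ * z := fun i j => by
      have h2 : redRes X i j = redRes Y i j := by rw [h]
      have h3 : X i j - Y i j ∈ IsLocalRing.maximalIdeal O := by
        rw [← IsLocalRing.residue_eq_zero_iff, map_sub, sub_eq_zero]
        exact h2
      rw [hm, Ideal.mem_span_singleton] at h3
      obtain ⟨z, hz⟩ := h3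
      exact ⟨z, by rw [← hz]; ring⟩
    choose Z hZ using h1
    exact ⟨Matrix.of Z, by ext i j; simp [hZ]⟩
  · rintro ⟨Z, rfl⟩
    rw [redRes_add, redRes_smul, residue_uniformizer hm, zero_smul, add_zero]

lemma mem_congruenceSubgroup_iff {i r : ℕ} (hir : i ≤ r) (k : GLmod O n r) :
    k ∈ congruenceSubgroup O n hir ↔ ∃ X, k.val = redPow r (1 + ϖ ^ i • X) := by
  obtain ⟨Y, hY⟩ := redPow_surjective r k.val
  have h1 : (Matrix.GeneralLinearGroup.map
      (Ideal.Quotient.factorPow (IsLocalRing.maximalIdeal O) hir) k).val = redPow i Y := by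
    ext a b
    rw [Matrix.GeneralLinearGroup.map_apply, ← hY]
    rfl
  rw [congruenceSubgroup, MonoidHom.mem_ker]
  constructor
  · intro h
    rw [h, Units.val_one, ← redPow_one] at h1
    obtain ⟨Z, hZ⟩ := (redPow_eq_iff hm).mp h1.symm
    exact ⟨Z, by rw [← hY, hZ]⟩
  · rintro ⟨Z, hZ⟩
    rw [← hY, redPow_eq_iff hm] at hZ
    obtain ⟨Z', rfl⟩ := hZ
    refine Units.ext ?_
    rw [h1, redPow_add, redPow_add, redPow_smul, redPow_smul,
      mk_uniformizer_pow_eq_zero hm le_rfl, mk_uniformizer_pow_eq_zero hm hir, redPow_one]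
    simp

lemma exists_congruenceSubgroup_val_eq {i r : ℕ} (hi : 0 < i) (hir : i ≤ r)
    (X : Matrix (Fin n) (Fin n) O) :
    ∃ k : congruenceSubgroup O n hir, k.1.val = redPow r (1 + ϖ ^ i • X) := by
  have h1 : IsNilpotent (redPow r (ϖ ^ i • X)) := by
    refine ⟨r, ?_⟩
    rw [redPow_smul, smul_pow, ← map_pow, ← pow_mul,
      mk_uniformizer_pow_eq_zero hm (Nat.le_mul_of_pos_left r hi), zero_smul]
  obtain ⟨k, hk⟩ := h1.isUnit_one_add
  have h2 : k.val = redPow r (1 + ϖ ^ i • X) := by rw [hk, redPow_add, redPow_one]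
  exact ⟨⟨k, (mem_congruenceSubgroup_iff hm hir k).mpr ⟨X, h2⟩⟩, h2⟩

end CongruenceElements

/-! ### The group law of K_{l-1} in exponential coordinates. -/

section KPredElements

variable {O : Type*} [CommRing O] [IsLocalRing O] {n l : ℕ} {ϖ t : O}

lemma KPred_ext {k k' : KPred O n l} (h : k.1.val = k'.1.val) : k = k' :=
  Subtype.ext (Units.ext h)

variable (hl : 2 ≤ l) (hm : IsLocalRing.maximalIdeal O = Ideal.span {ϖ})

include hl hm

lemma exists_KPred_truncExp (t : O) (X : Matrix (Fin n) (Fin n) O) :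
    ∃ k : KPred O n l, k.1.val = redPow (2 * l - 1) (truncExp (ϖ ^ (l - 1)) t X) := by
  obtain ⟨k, hk⟩ := exists_congruenceSubgroup_val_eq hm (i := l - 1) (r := 2 * l - 1) (by omega)
    (by omega) (X + (t * ϖ ^ (l - 1)) • (X * X))
  refine ⟨k, hk.trans ?_⟩
  congr 1
  rw [truncExp, smul_add, smul_smul, add_assoc]
  congr 3
  ring

lemma exists_KPred_one_add (Z : Matrix (Fin n) (Fin n) O) :
    ∃ k : KPred O n l, k.1.val = redPow (2 * l - 1) (1 + ϖ ^ l • Z) := by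
  obtain ⟨k, hk⟩ := exists_congruenceSubgroup_val_eq hm (i := l - 1) (r := 2 * l - 1) (by omega)
    (by omega) (ϖ • Z)
  refine ⟨k, hk.trans ?_⟩
  rw [smul_smul, ← pow_succ, Nat.sub_add_cancel (by omega)]

/-- The inequality 3(l-1) ≥ 2l-1 is exactly l ≥ 2. -/
lemma mk_pow_pred_cube :
    Ideal.Quotient.mk (IsLocalRing.maximalIdeal O ^ (2 * l - 1)) (ϖ ^ (l - 1)) ^ 3 = 0 := by
  rw [← map_pow, ← pow_mul]
  exact mk_uniformizer_pow_eq_zero hm (by omega)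

lemma KPred_eq_truncExp (t : O) (k : KPred O n l) :
    ∃ X, k.1.val = redPow (2 * l - 1) (truncExp (ϖ ^ (l - 1)) t X) := by
  obtain ⟨Y, hY⟩ := (mem_congruenceSubgroup_iff hm _ k.1).mp k.2
  refine ⟨Y - (t * ϖ ^ (l - 1)) • (Y * Y), ?_⟩
  rw [redPow_truncExp, redPow_sub, redPow_smul, redPow_mul, map_mul,
    truncExp_sub_smul (mk_pow_pred_cube hl hm), hY, redPow_add, redPow_smul, redPow_one]

/-- The correction ½ϖ^{2l-2}[X,Y] is written with a factor ϖ^l taken out, to show it as an element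
of K_l on which ψ_β can be evaluated. -/
lemma KPred_truncExp_mul (ht : 2 * t = 1) {X Y : Matrix (Fin n) (Fin n) O}
    {kx ky kxy kz : KPred O n l}
    (hx : kx.1.val = redPow (2 * l - 1) (truncExp (ϖ ^ (l - 1)) t X))
    (hy : ky.1.val = redPow (2 * l - 1) (truncExp (ϖ ^ (l - 1)) t Y))
    (hxy : kxy.1.val = redPow (2 * l - 1) (truncExp (ϖ ^ (l - 1)) t (X + Y)))
    (hz : kz.1.val = redPow (2 * l - 1)
      (1 + ϖ ^ l • ((t * ϖ ^ (l - 2)) • (X * Y - Y * X)))) :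
    kx * ky = kxy * kz := by
  apply KPred_ext
  have e : ϖ ^ l * (t * ϖ ^ (l - 2)) = t * (ϖ ^ (l - 1)) ^ 2 := by
    obtain ⟨m, rfl⟩ := Nat.exists_eq_add_of_le' hl
    simp only [Nat.add_sub_cancel, show m + 2 - 1 = m + 1 by omega]
    ring
  change kx.1.val * ky.1.val = kxy.1.val * kz.1.val
  rw [hx, hy, hxy, hz, smul_smul, e, redPow_truncExp, redPow_truncExp, redPow_truncExp,
    redPow_add _ 1, redPow_one, redPow_smul, redPow_sub, redPow_mul, redPow_mul, map_mul, map_pow,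
    redPow_add]
  exact truncExp_mul (mk_pow_pred_cube hl hm) (by
    rw [← map_ofNat (Ideal.Quotient.mk _), ← map_mul, ht, map_one]) _ _

/-- Changing X by ϖZ matters only to first order, since (ϖ^{l-1})²ϖ = ϖ^r. -/
lemma KPred_truncExp_add_smul {X Z : Matrix (Fin n) (Fin n) O}
    {kx kxz kz : KPred O n l}
    (hx : kx.1.val = redPow (2 * l - 1) (truncExp (ϖ ^ (l - 1)) t X))
    (hxz : kxz.1.val = redPow (2 * l - 1) (truncExp (ϖ ^ (l - 1)) t (X + ϖ • Z)))
    (hz : kz.1.val = redPow (2 * l - 1) (1 + ϖ ^ l • Z)) :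
    kxz = kx * kz := by
  apply KPred_ext
  have e : ϖ ^ l = ϖ ^ (l - 1) * ϖ := by rw [← pow_succ, Nat.sub_add_cancel (by omega)]
  change kxz.1.val = kx.1.val * kz.1.val
  rw [hx, hxz, hz, e, redPow_truncExp, redPow_truncExp, redPow_add _ 1, redPow_one, redPow_smul,
    redPow_add, redPow_smul, map_mul]
  refine truncExp_add_smul ?_ _ _
  rw [← map_pow, ← map_mul, ← pow_mul, ← pow_succ]
  exact mk_uniformizer_pow_eq_zero hm (by omega)

/-- `K_l` is central in `K_{l-1}`. -/
lemma KPred_commute {Z : Matrix (Fin n) (Fin n) O} {kz : KPred O n l}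
    (hz : kz.1.val = redPow (2 * l - 1) (1 + ϖ ^ l • Z)) (k : KPred O n l) :
    kz * k = k * kz := by
  apply KPred_ext
  obtain ⟨Y, hY⟩ := (mem_congruenceSubgroup_iff hm _ k.1).mp k.2
  change kz.1.val * k.1.val = k.1.val * kz.1.val
  rw [hz, hY, ← redPow_mul, ← redPow_mul, redPow_eq_iff hm]
  have e : ϖ ^ l * ϖ ^ (l - 1) = ϖ ^ (2 * l - 1) := by rw [← pow_add]; congr 1; omega
  refine ⟨Z * Y - Y * Z, ?_⟩
  rw [← e]
  simp only [mul_add, add_mul, one_mul, mul_one, smul_mul_smul_comm, smul_sub,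
    mul_comm (ϖ ^ (l - 1))]
  abel

end KPredElements

/-! ### Elements of `𝒞` -/

section CBetaElements

variable {O : Type*} [CommRing O] [IsLocalRing O] {n l : ℕ} {β : Matrix (Fin n) (Fin n) O}

/-- Lift a polynomial in β_r coefficient by coefficient to a polynomial in β. It commutes with β
over O, not just modulo 𝔭^r, and its reduction commutes with the centralizer of β̄. -/
lemma CBeta_exists_lift (ε : CBeta l β) : ∃ e : Matrix (Fin n) (Fin n) O,
    (CBeta.toGL β ε).val = redPow (2 * l - 1) e ∧ β * e = e * β ∧
      ∀ Z, redRes β * Z = Z * redRes β → redRes e * Z = Z * redRes e := by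
  have h : ∀ x ∈ Algebra.adjoin (O ⧸ IsLocalRing.maximalIdeal O ^ (2 * l - 1))
      {redPow (2 * l - 1) β}, ∃ e : Matrix (Fin n) (Fin n) O,
      x = redPow (2 * l - 1) e ∧ β * e = e * β ∧
      ∀ Z, redRes β * Z = Z * redRes β → redRes e * Z = Z * redRes e := fun x hx => by
    induction hx using Algebra.adjoin_induction with
    | mem x hx =>
      rw [Set.mem_singleton_iff] at hx
      exact ⟨β, hx, rfl, fun _ hZ => hZ⟩
    | algebraMap a =>
      obtain ⟨a, rfl⟩ := Ideal.Quotient.mk_surjective a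
      refine ⟨a • 1, ?_, by simp, fun Z _ => ?_⟩
      · rw [redPow_smul, redPow_one, Algebra.algebraMap_eq_smul_one]
      · rw [redRes_smul, redRes_one]; simp
    | add x y _ _ hx hy =>
      obtain ⟨e, rfl, h1, h2⟩ := hx
      obtain ⟨e', rfl, h1', h2'⟩ := hy
      refine ⟨e + e', (redPow_add _ _ _).symm, by rw [mul_add, add_mul, h1, h1'], fun Z hZ => ?_⟩
      rw [redRes_add, add_mul, mul_add, h2 Z hZ, h2' Z hZ]
    | mul x y _ _ hx hy =>
      obtain ⟨e, rfl, h1, h2⟩ := hx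
      obtain ⟨e', rfl, h1', h2'⟩ := hy
      refine ⟨e * e', (redPow_mul _ _ _).symm, ?_, fun Z hZ => ?_⟩
      · rw [← mul_assoc, h1, mul_assoc, h1', mul_assoc]
      · rw [redRes_mul, mul_assoc, h2' Z hZ, ← mul_assoc, h2 Z hZ, mul_assoc]
  exact h _ ε.val.2

end CBetaElements

/-! ### Conjugation by 𝒞 through lifts to M_n(O). -/

section Lift

variable {O : Type*} [CommRing O] [IsLocalRing O] {n l : ℕ} {ϖ t : O}
  {β : Matrix (Fin n) (Fin n) O}

lemma redRes_eq_one_of_redPow_eq_one (hm : IsLocalRing.maximalIdeal O = Ideal.span {ϖ}) {r : ℕ}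
    (hr : 0 < r) {X : Matrix (Fin n) (Fin n) O} (h : redPow r X = 1) : redRes X = 1 := by
  rw [← redPow_one, redPow_eq_iff hm] at h
  obtain ⟨Z, rfl⟩ := h
  rw [redRes_add, redRes_smul, map_pow, residue_uniformizer hm, zero_pow hr.ne', zero_smul,
    add_zero, redRes_one]

lemma redPow_lift_mul_lift {ε : CBeta l β} {e e' : Matrix (Fin n) (Fin n) O}
    (he : (CBeta.toGL β ε).val = redPow (2 * l - 1) e)
    (he' : (CBeta.toGL β ε⁻¹).val = redPow (2 * l - 1) e') :
    redPow (2 * l - 1) (e * e') = 1 ∧ redPow (2 * l - 1) (e' * e) = 1 := by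
  rw [redPow_mul, redPow_mul, ← he, ← he', ← Units.val_mul, ← Units.val_mul, ← map_mul, ← map_mul,
    mul_inv_cancel, inv_mul_cancel, map_one, Units.val_one]
  exact ⟨rfl, rfl⟩

lemma conjNormal_truncExp {ε : CBeta l β} {e e' : Matrix (Fin n) (Fin n) O}
    (he : (CBeta.toGL β ε).val = redPow (2 * l - 1) e)
    (he' : (CBeta.toGL β ε⁻¹).val = redPow (2 * l - 1) e')
    {k : KPred O n l} {a : O} {X : Matrix (Fin n) (Fin n) O}
    (hk : k.1.val = redPow (2 * l - 1) (truncExp a t X)) :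
    (MulAut.conjNormal (CBeta.toGL β ε) k : KPred O n l).1.val =
      redPow (2 * l - 1) (truncExp a t (e * X * e')) := by
  obtain ⟨h1, h2⟩ := redPow_lift_mul_lift he he'
  rw [redPow_mul] at h1 h2
  rw [MulAut.conjNormal_apply, ← map_inv, Units.val_mul, Units.val_mul, hk, he, he',
    redPow_truncExp, redPow_truncExp, conj_truncExp h1 h2, redPow_mul, redPow_mul]

end Lift

/-! ### The operators attached to a representation of `K_{l-1}` -/

section TraceChar

variable {O : Type*} [CommRing O] {n : ℕ} {ϖ : O}
  {F : Type*} [Field F] [Algebra O F]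

/-- The additive character `X ↦ τ (ϖ^{-j} tr (X β))` of `M_n(O)`. -/
noncomputable def traceChar (τ : AddChar F Circle) (ϖ : O) (j : ℕ) (β X : Matrix (Fin n) (Fin n) O) : ℂ :=
  τ ((algebraMap O F ϖ ^ j)⁻¹ * algebraMap O F (X * β).trace)

variable {τ : AddChar F Circle} {β : Matrix (Fin n) (Fin n) O}

lemma traceChar_add (j : ℕ) (X Y : Matrix (Fin n) (Fin n) O) :
    traceChar τ ϖ j β (X + Y) = traceChar τ ϖ j β X * traceChar τ ϖ j β Y := by
  rw [traceChar, traceChar, traceChar, add_mul, Matrix.trace_add, map_add, mul_add,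
    AddChar.map_add_eq_mul, Circle.coe_mul]

lemma traceChar_zero (j : ℕ) : traceChar τ ϖ j β 0 = 1 := by
  simp [traceChar]

lemma traceChar_ne_zero (j : ℕ) (X : Matrix (Fin n) (Fin n) O) : traceChar τ ϖ j β X ≠ 0 :=
  Circle.coe_ne_zero _

lemma traceChar_pow_smul (hϖ : algebraMap O F ϖ ≠ 0) (i j : ℕ) (X : Matrix (Fin n) (Fin n) O) :
    traceChar τ ϖ (i + j) β (ϖ ^ i • X) = traceChar τ ϖ j β X := by
  rw [traceChar, traceChar, smul_mul_assoc, Matrix.trace_smul, smul_eq_mul,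
    map_mul (algebraMap O F), map_pow, pow_add, mul_inv, mul_comm _⁻¹,
    mul_assoc, inv_mul_cancel_left₀ (pow_ne_zero i hϖ)]

lemma traceChar_zero_left (hτ : ∀ y : O, τ (algebraMap O F y) = 1)
    (X : Matrix (Fin n) (Fin n) O) : traceChar τ ϖ 0 β X = 1 := by
  rw [traceChar, pow_zero, inv_one, one_mul, hτ, Circle.coe_one]

end TraceChar

section Operators

variable {O : Type*} [CommRing O] [IsLocalRing O] {n l : ℕ} {ϖ t : O}
  {F : Type*} [Field F] [Algebra O F] {τ : AddChar F Circle} {β : Matrix (Fin n) (Fin n) O}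

/-- The lifts e and e' are inverse only modulo ϖ^{2l-1}; against ϖ^{-l} the error still lies in O,
where τ is trivial. -/
lemma traceChar_conj (hϖ : algebraMap O F ϖ ≠ 0) (hτ : ∀ y : O, τ (algebraMap O F y) = 1)
    (hm : IsLocalRing.maximalIdeal O = Ideal.span {ϖ})
    {e e' : Matrix (Fin n) (Fin n) O} (h : redPow (2 * l - 1) (e' * e) = 1)
    (hβ : β * e = e * β) (hl : 2 ≤ l) (X : Matrix (Fin n) (Fin n) O) :
    traceChar τ ϖ l β (e * X * e') = traceChar τ ϖ l β X := by
  rw [← redPow_one, redPow_eq_iff hm] at h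
  obtain ⟨Z, hZ⟩ := h
  have h1 : (e * X * e' * β).trace = ((X + ϖ ^ (2 * l - 1) • (X * Z)) * β).trace := by
    rw [mul_assoc, mul_assoc e, Matrix.trace_mul_comm, mul_assoc, mul_assoc, hβ, ← mul_assoc e',
      hZ, ← mul_assoc, mul_add, mul_one, mul_smul_comm]
  rw [traceChar, h1, ← traceChar, traceChar_add,
    show ϖ ^ (2 * l - 1) • (X * Z) = ϖ ^ l • (ϖ ^ (l - 1) • (X * Z)) by
      rw [smul_smul, ← pow_add]; congr 2; omega]
  have h2 := traceChar_pow_smul (τ := τ) (β := β) hϖ l 0 (ϖ ^ (l - 1) • (X * Z))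
  rw [add_zero, traceChar_zero_left hτ] at h2
  rw [h2, mul_one]

/-- The character `a mod 𝔭 ↦ τ (ϖ⁻¹ a)` of the residue field. -/
lemma exists_residueChar (hϖ : algebraMap O F ϖ ≠ 0) (hτ : ∀ y : O, τ (algebraMap O F y) = 1)
    (hm : IsLocalRing.maximalIdeal O = Ideal.span {ϖ}) :
    ∃ θ : AddChar (IsLocalRing.ResidueField O) ℂ, ∀ a : O,
      θ (IsLocalRing.residue O a) = τ ((algebraMap O F ϖ)⁻¹ * algebraMap O F a) := by
  have h1 : ∀ a b : O, IsLocalRing.residue O a = IsLocalRing.residue O b →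
      τ ((algebraMap O F ϖ)⁻¹ * algebraMap O F a) =
        τ ((algebraMap O F ϖ)⁻¹ * algebraMap O F b) := fun a b h => by
    rw [← sub_eq_zero, ← map_sub, IsLocalRing.residue_eq_zero_iff, hm,
      Ideal.mem_span_singleton] at h
    obtain ⟨c, hc⟩ := h
    rw [sub_eq_iff_eq_add.mp hc, map_add, map_mul (algebraMap O F), mul_add, inv_mul_cancel_left₀ hϖ,
      AddChar.map_add_eq_mul, hτ, one_mul]
  let s := Function.surjInv (IsLocalRing.residue_surjective (R := O))
  have hs : ∀ x, IsLocalRing.residue O (s x) = x := Function.surjInv_eq _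
  refine ⟨{ toFun := fun x => τ ((algebraMap O F ϖ)⁻¹ * algebraMap O F (s x))
            map_zero_eq_one' := ?_
            map_add_eq_mul' := fun x y => ?_ }, fun a => ?_⟩
  · rw [h1 (s 0) 0 (by rw [hs, map_zero])]
    simp
  · rw [h1 (s (x + y)) (s x + s y) (by rw [map_add, hs, hs, hs]), map_add, mul_add,
      AddChar.map_add_eq_mul, Circle.coe_mul]
  · exact congrArg (fun z : Circle => (z : ℂ)) (h1 _ _ (hs _))

variable {H : Type*} [AddCommGroup H] [Module ℂ H] {π : Representation ℂ (KPred O n l) H}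

/-- An irreducible representation of `K_{l-1}` in which `K_l` acts by `ψ_β` is, up to a character,
given by operators indexed by `M_n(𝔽)`. -/
lemma exists_isMatrixHeisenberg [Finite (KPred O n l)] (hl : 2 ≤ l)
    (hϖ : algebraMap O F ϖ ≠ 0)
    (hm : IsLocalRing.maximalIdeal O = Ideal.span {ϖ}) (ht : 2 * t = 1)
    {θ : AddChar (IsLocalRing.ResidueField O) ℂ}
    (hθ : ∀ a : O, θ (IsLocalRing.residue O a) = τ ((algebraMap O F ϖ)⁻¹ * algebraMap O F a))
    (hπ : π.IsIrreducible)
    (hcen : ∀ (k : KPred O n l) (Z : Matrix (Fin n) (Fin n) O),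
      k.1.val = redPow (2 * l - 1) (1 + ϖ ^ l • Z) → π k = traceChar τ ϖ (l - 1) β Z • 1) :
    ∃ A : Matrix (Fin n) (Fin n) (IsLocalRing.ResidueField O) → Module.End ℂ H,
      IsMatrixHeisenberg (redRes β) θ (IsLocalRing.residue O t) A ∧
      ∀ (k : KPred O n l) (X : Matrix (Fin n) (Fin n) O),
        k.1.val = redPow (2 * l - 1) (truncExp (ϖ ^ (l - 1)) t X) →
          π k = traceChar τ ϖ l β X • A (redRes X) := by
  choose E hE using exists_KPred_truncExp (n := n) hl hm t
  choose κ hκ using exists_KPred_one_add (n := n) hl hm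
  -- The value of the divisor at ϖZ is ψ_β(1 + ϖ^l Z), so the quotient depends only on X mod 𝔭.
  let A₀ : Matrix (Fin n) (Fin n) O → Module.End ℂ H := fun X =>
    (traceChar τ ϖ l β X)⁻¹ • π (E X)
  have hπE : ∀ X, π (E X) = traceChar τ ϖ l β X • A₀ X := fun X => by
    simp only [A₀]
    rw [smul_smul, mul_inv_cancel₀ (traceChar_ne_zero _ _), one_smul]
  have hA₀ : ∀ X Y, redRes X = redRes Y → A₀ X = A₀ Y := fun X Y h => by
    obtain ⟨Z, rfl⟩ := (redRes_eq_iff hm).mp h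
    have h1 := KPred_truncExp_add_smul hl hm (hE Y) (hE _) (hκ Z)
    have h2 : traceChar τ ϖ l β (ϖ • Z) = traceChar τ ϖ (l - 1) β Z := by
      have := traceChar_pow_smul (τ := τ) (β := β) hϖ 1 (l - 1) Z
      rwa [pow_one, add_comm, Nat.sub_add_cancel (by omega)] at this
    simp only [A₀]
    rw [h1, map_mul, hcen _ _ (hκ Z), mul_smul_comm, mul_one, traceChar_add, smul_smul, h2,
      mul_inv, inv_mul_cancel_right₀ (traceChar_ne_zero _ _)]
  have hmul : ∀ X Y, A₀ X * A₀ Y =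
      θ (IsLocalRing.residue O t * ((redRes X * redRes Y - redRes Y * redRes X) *
        redRes β).trace) • A₀ (X + Y) := fun X Y => by
    have h1 := KPred_truncExp_mul hl hm ht (hE X) (hE Y) (hE (X + Y)) (hκ _)
    have h2 : traceChar τ ϖ (l - 1) β ((t * ϖ ^ (l - 2)) • (X * Y - Y * X)) =
        θ (IsLocalRing.residue O t * ((redRes X * redRes Y - redRes Y * redRes X) *
          redRes β).trace) := by
      -- The factor ϖ^{l-2} against ϖ^{-(l-1)} leaves ϖ⁻¹, which is how θ arises.
      have h3 := traceChar_pow_smul (τ := τ) (β := β) hϖ (l - 2) 1 (t • (X * Y - Y * X))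
      rw [smul_smul, mul_comm _ t, show l - 2 + 1 = l - 1 by omega] at h3
      rw [h3, ← redRes_mul, ← redRes_mul, ← redRes_sub, ← redRes_mul, redRes_trace, ← map_mul, hθ,
        traceChar, pow_one, smul_mul_assoc, Matrix.trace_smul, smul_eq_mul]
    simp only [A₀]
    rw [smul_mul_smul_comm, ← map_mul, h1, map_mul, hcen _ _ (hκ _), h2, mul_smul_comm, mul_one,
      smul_smul, smul_smul, traceChar_add, mul_inv, mul_comm]
  let s := Function.surjInv (redRes_surjective (O := O) (n := n))
  have hs : ∀ x, redRes (s x) = x := Function.surjInv_eq _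
  have hAs : ∀ X, A₀ (s (redRes X)) = A₀ X := fun X => hA₀ _ _ (hs _)
  have hk : ∀ (k : KPred O n l) (X : Matrix (Fin n) (Fin n) O),
      k.1.val = redPow (2 * l - 1) (truncExp (ϖ ^ (l - 1)) t X) →
        π k = traceChar τ ϖ l β X • A₀ (s (redRes X)) := fun k X h => by
    rw [hAs, ← hπE, KPred_ext (h.trans (hE X).symm)]
  refine ⟨fun x => A₀ (s x), ⟨?_, fun x y => ?_, fun T hT => ?_⟩, hk⟩
  · have h1 : A₀ (s 0) = A₀ 0 := hA₀ _ _ (by rw [hs]; ext; simp [redRes])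
    have h2 : E 0 = 1 := KPred_ext ((hE 0).trans (by rw [truncExp_zero, redPow_one]; rfl))
    rw [h1]
    simp only [A₀]
    rw [h2, map_one, traceChar_zero, inv_one, one_smul]
  · have h1 : A₀ (s (x + y)) = A₀ (s x + s y) := hA₀ _ _ (by rw [redRes_add, hs, hs, hs])
    rw [h1, hmul, hs, hs]
  · refine hπ.exists_eq_smul_one_of_commute fun k => ?_
    obtain ⟨X, hX⟩ := KPred_eq_truncExp hl hm t k
    rw [hk k X hX, mul_smul_comm, smul_mul_assoc, hT]

end Operators

/-! ### Existence and triviality of c(ψ). -/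

section Main

variable {O : Type*} [CommRing O] [IsLocalRing O] {n l : ℕ} {ϖ t : O}
  {F : Type*} [Field F] [Algebra O F] {τ : AddChar F Circle} {β : Matrix (Fin n) (Fin n) O}

/-- `K_l` acts on `π_ψ` by `ψ_β`. -/
lemma IsPiPsi.apply_eq_traceChar [Finite (KPred O n l)] {hl : 2 ≤ l}
    (hm : IsLocalRing.maximalIdeal O = Ideal.span {ϖ})
    {ψ : KPredBeta hl ϖ β →* ℂˣ} (hψ : ψ ∈ YSet τ hl ϖ β)
    {H : Type*} [AddCommGroup H] [Module ℂ H] {π : Representation ℂ (KPred O n l) H}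
    (hπ : IsPiPsi ψ π) (k : KPred O n l) (Z : Matrix (Fin n) (Fin n) O)
    (hk : k.1.val = redPow (2 * l - 1) (1 + ϖ ^ l • Z)) :
    π k = traceChar τ ϖ (l - 1) β Z • 1 := by
  obtain ⟨hirr, v, hv0, hv⟩ := hπ
  -- Centrality makes `π k` a scalar, which is then read off on the ψ-eigenvector.
  obtain ⟨c, hc⟩ := hirr.exists_eq_smul_one_of_commute (T := π k) fun k' => by
    rw [← map_mul, ← map_mul, KPred_commute hl hm hk]
  have hmem : k.1 ∈ KPredBeta hl ϖ β := by
    refine ⟨k.2, ϖ • Z, ?_, ?_⟩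
    · rw [redRes_smul, residue_uniformizer hm, zero_smul]
      exact zero_mem _
    · rw [hk, smul_smul, ← pow_succ, Nat.sub_add_cancel (by omega)]
  have h1 := hv ⟨k.1, hmem⟩
  rw [hψ ⟨k.1, hmem⟩ Z hk, ← traceChar] at h1
  have h2 : c • v = traceChar τ ϖ (l - 1) β Z • v := by
    rw [← h1]
    exact (congrArg (fun T : Module.End ℂ H => T v) hc).symm
  rw [hc, smul_left_injective ℂ hv0 h2]

lemma exists_CBeta_lifts (hl : 2 ≤ l) (hm : IsLocalRing.maximalIdeal O = Ideal.span {ϖ}) :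
    ∃ s : CBeta l β → Matrix (Fin n) (Fin n) O,
      (∀ ε, (CBeta.toGL β ε).val = redPow (2 * l - 1) (s ε)) ∧ (∀ ε, β * s ε = s ε * β) ∧
      (∀ ε Z, redRes β * Z = Z * redRes β → redRes (s ε) * Z = Z * redRes (s ε)) ∧
      (∀ ε, redPow (2 * l - 1) (s ε⁻¹ * s ε) = 1) ∧
      (∀ ε, redRes (s ε) * redRes (s ε⁻¹) = 1) ∧ (∀ ε, redRes (s ε⁻¹) * redRes (s ε) = 1) := by
  choose s hs1 hs2 hs3 using CBeta_exists_lift (β := β) (l := l)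
  have h := fun ε => redPow_lift_mul_lift (hs1 ε) (hs1 ε⁻¹)
  refine ⟨s, hs1, hs2, hs3, fun ε => (h ε).2, fun ε => ?_, fun ε => ?_⟩
  · rw [← redRes_mul]
    exact redRes_eq_one_of_redPow_eq_one hm (by omega) (h ε).1
  · rw [← redRes_mul]
    exact redRes_eq_one_of_redPow_eq_one hm (by omega) (h ε).2

/-- Since σ is a homomorphism, U(gh)⁻¹U(g)U(h) commutes with π and is scalar by Schur; the two
evaluations of U(g)U(h)U(j) on a vector give the cocycle identity. -/
lemma exists_twoCocycle {G H K : Type*} [Group G] [Group K] [Finite K] [AddCommGroup H] [Module ℂ H]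
    {π : Representation ℂ K H} (hπ : π.IsIrreducible) (σ : G →* MulAut K) (U : G → (H ≃ₗ[ℂ] H))
    (hU : ∀ g k, π (σ g k) * (U g).toLinearMap = (U g).toLinearMap * π k) :
    ∃ c : twoCocycles G ℂˣ, ∀ g h, (U g).toLinearMap ∘ₗ (U h).toLinearMap =
      ((c.1 (g, h) : ℂˣ) : ℂ) • (U (g * h)).toLinearMap := by
  have := hπ.nontrivial_space
  obtain ⟨v, hv⟩ := exists_ne (0 : H)
  have hU' : ∀ g k x, π (σ g k) (U g x) = U g (π k x) := fun g k x =>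
    congrArg (fun T : Module.End ℂ H => T x) (hU g k)
  have h1 : ∀ g h, ∃ c : ℂ, ∀ x, U g (U h x) = c • U (g * h) x := fun g h => by
    obtain ⟨c, hc⟩ := hπ.exists_eq_smul_one_of_commute
      (T := (U (g * h)).symm.toLinearMap ∘ₗ (U g).toLinearMap ∘ₗ (U h).toLinearMap) fun k => by
        ext x
        simp only [Module.End.mul_apply, LinearMap.comp_apply, LinearEquiv.coe_coe]
        rw [LinearEquiv.symm_apply_eq, ← hU' (g * h), LinearEquiv.apply_symm_apply,
          ← hU' h, ← hU' g, map_mul]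
        rfl
    refine ⟨c, fun x => ?_⟩
    have := congrArg (fun T : Module.End ℂ H => T x) hc
    simp only [LinearMap.comp_apply, LinearEquiv.coe_coe, LinearMap.smul_apply,
      Module.End.one_apply] at this
    rw [LinearEquiv.symm_apply_eq] at this
    rw [this, map_smul]
  choose c hc using h1
  have hc0 : ∀ g h, c g h ≠ 0 := fun g h h0 => by
    have := hc g h v
    rw [h0, zero_smul] at this
    simp [hv] at this
  refine ⟨⟨fun p => Units.mk0 (c p.1 p.2) (hc0 _ _), fun g h j => Units.ext ?_⟩, fun g h => ?_⟩
  · simp only [Units.val_mul, Units.val_mk0]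
    have e1 : U g (U h (U j v)) = (c (g * h) j * c g h) • U (g * h * j) v := by
      rw [hc, hc, smul_smul, mul_comm]
    have e2 : U g (U h (U j v)) = (c h j * c g (h * j)) • U (g * h * j) v := by
      rw [hc h j, map_smul, hc, smul_smul, mul_assoc]
    have hne : U (g * h * j) v ≠ 0 := by simpa using hv
    exact smul_left_injective ℂ hne (e1.symm.trans e2)
  · ext x
    exact hc g h x

/-- If the characteristic polynomial of `β̄` is separable, then the Schur multipliers exist and are
trivial. -/
theorem schurHypothesis_of_separable [Finite (KPred O n l)]
    [Finite (IsLocalRing.ResidueField O)] (hl : 2 ≤ l) (hϖ : algebraMap O F ϖ ≠ 0)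
    (hm : IsLocalRing.maximalIdeal O = Ideal.span {ϖ}) (ht : 2 * t = 1)
    (hτ : ∀ y : O, τ (algebraMap O F y) = 1)
    (hτ' : ∃ y : O, τ ((algebraMap O F ϖ)⁻¹ * algebraMap O F y) ≠ 1)
    (hsep : (redRes β).charpoly.Separable) : SchurHypothesis τ hl ϖ β := by
  intro ψ hψ
  obtain ⟨θ, hθ⟩ := exists_residueChar hϖ hτ hm
  have hθ1 : ∃ c, θ c ≠ 1 := by
    obtain ⟨y, hy⟩ := hτ'
    exact ⟨IsLocalRing.residue O y, fun h => hy (Circle.ext (by rw [← hθ, h, Circle.coe_one]))⟩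
  have ht' : 2 * IsLocalRing.residue O t = 1 := by
    rw [← map_ofNat (IsLocalRing.residue O), ← map_mul, ht, map_one]
  obtain ⟨s, hs1, hs2, hs3, hs4, hs5, hs6⟩ := exists_CBeta_lifts (β := β) hl hm
  have hconj : ∀ (ε : CBeta l β) (X : Matrix (Fin n) (Fin n) O),
      traceChar τ ϖ l β (s ε * X * s ε⁻¹) = traceChar τ ϖ l β X := fun ε X =>
    traceChar_conj hϖ hτ hm (hs4 ε) (hs2 ε) hl X
  constructor
  · let i : KPredBeta hl ϖ β →* KPred O n l :=
      Subgroup.inclusion (congruenceSubgroupOf_le (i := l - 1) (by omega) (by omega) ϖ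
        (residueAlgebra β))
    obtain ⟨d, π, hirr, hv⟩ := Representation.exists_isIrreducible_eigenvector i
      (Subgroup.inclusion_injective _) ψ
    have hπ : IsPiPsi ψ π := ⟨hirr, hv⟩
    have := hirr.nontrivial_space
    obtain ⟨A, hA, hAπ⟩ := exists_isMatrixHeisenberg hl hϖ hm ht hθ hirr
      (hπ.apply_eq_traceChar hm hψ)
    choose U hU using fun ε => hA.exists_intertwiner hsep ht' hθ1 (hs5 ε) (hs6 ε) (hs3 ε)
    have hUπ : ∀ (ε : CBeta l β) (k : KPred O n l),
        π (MulAut.conjNormal (CBeta.toGL β ε) k) * (U ε).toLinearMap =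
          (U ε).toLinearMap * π k := fun ε k => by
      obtain ⟨X, hX⟩ := KPred_eq_truncExp hl hm t k
      rw [hAπ _ _ (conjNormal_truncExp (hs1 ε) (hs1 ε⁻¹) hX), hAπ _ _ hX, hconj, redRes_mul,
        redRes_mul, smul_mul_assoc, mul_smul_comm, hU]
    obtain ⟨c, hc⟩ := exists_twoCocycle hirr (MulAut.conjNormal.comp (CBeta.toGL β)) U hUπ
    refine ⟨QuotientGroup.mk c, _, _, _, π, U, c, hπ, fun ε k => ?_, hc, rfl⟩
    rw [← LinearMap.comp_assoc, LinearEquiv.eq_comp_toLinearMap_symm]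
    exact hUπ ε k
  · rintro _ ⟨H, _, _, π, U, c, hπ, hU, hc, rfl⟩
    have hirr := hπ.1
    have := hirr.nontrivial_space
    have := hirr.finiteDimensional_space
    obtain ⟨A, hA, hAπ⟩ := exists_isMatrixHeisenberg hl hϖ hm ht hθ hirr
      (hπ.apply_eq_traceChar hm hψ)
    obtain ⟨x, hx⟩ := hA.exists_coboundary hsep ht' hθ1 (fun ε => redRes (s ε))
      (fun ε => redRes (s ε⁻¹)) hs5 hs6
      (fun ε => (hs3 ε _ rfl).symm) (fun ε => (hs3 ε⁻¹ _ rfl).symm) U (fun ε η => c.1 (ε, η))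
      (fun ε X => by
        obtain ⟨X, rfl⟩ := redRes_surjective X
        obtain ⟨k, hk⟩ := exists_KPred_truncExp hl hm t X
        have h1 := hU ε k
        rw [← LinearMap.comp_assoc, LinearEquiv.eq_comp_toLinearMap_symm,
          hAπ _ _ (conjNormal_truncExp (hs1 ε) (hs1 ε⁻¹) hk), hAπ _ _ hk, hconj, redRes_mul,
          redRes_mul, LinearMap.smul_comp, LinearMap.comp_smul] at h1
        -- Conjugation by ε leaves the normalizing scalar unchanged, so it cancels.
        exact smul_right_injective _ (traceChar_ne_zero l X) h1)
      (fun ε η => hc ε η)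
    rw [QuotientGroup.eq_one_iff, Subgroup.mem_subgroupOf]
    exact ⟨x, hx⟩

end Main

theorem mainTheorem2 {F : Type*} [Field F] [ValuativeRel F] [TopologicalSpace F]
    [IsNonarchimedeanLocalField F]
    (hodd : ringChar (IsLocalRing.ResidueField 𝒪[F]) ≠ 2)
    (ϖ : 𝒪[F]) (hϖ : Irreducible ϖ)
    (τ : AddChar F Circle) (hτ : Continuous τ)
    (hτO : ∀ x : F, (∀ y : 𝒪[F], τ (x * (y : F)) = 1) ↔ x ∈ 𝒪[F])
    (n l : ℕ) (hl : 2 ≤ l) (β : Matrix (Fin n) (Fin n) 𝒪[F]) :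
    ((redRes β).charpoly.Separable → SchurHypothesis τ hl ϖ β) ∧
    (Irreducible (redRes β).charpoly → SchurHypothesis τ hl ϖ β) := by
  have : Finite (IsLocalRing.ResidueField 𝒪[F]) := inferInstanceAs (Finite 𝓀[F])
  have hm : IsLocalRing.maximalIdeal 𝒪[F] = Ideal.span {ϖ} := hϖ.maximalIdeal_eq
  have hfin : Finite (𝒪[F] ⧸ IsLocalRing.maximalIdeal 𝒪[F] ^ (2 * l - 1)) := by
    have : Finite (𝒪[F] ⧸ IsLocalRing.maximalIdeal 𝒪[F]) := this
    exact Ideal.finite_quotient_pow (hm ▸ Submodule.fg_span_singleton ϖ) _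
  have : Finite (KPred 𝒪[F] n l) := inferInstance
  have hϖ0 : algebraMap 𝒪[F] F ϖ ≠ 0 := fun h => hϖ.ne_zero (Subtype.ext h)
  have h2 : IsUnit (2 : 𝒪[F]) := by
    rw [← IsLocalRing.residue_ne_zero_iff_isUnit, map_ofNat]
    exact Ring.two_ne_zero hodd
  obtain ⟨t, ht⟩ := h2.exists_right_inv
  have hτ1 : ∀ y : 𝒪[F], τ (algebraMap 𝒪[F] F y) = 1 := fun y => by
    have := (hτO 1).mpr (one_mem _) y
    rwa [one_mul] at this
  -- Otherwise the conductor condition would put ϖ⁻¹ in O.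
  have hτ2 : ∃ y : 𝒪[F], τ ((algebraMap 𝒪[F] F ϖ)⁻¹ * algebraMap 𝒪[F] F y) ≠ 1 := by
    by_contra! h
    have h1 := (hτO (algebraMap 𝒪[F] F ϖ)⁻¹).mp h
    exact hϖ.not_isUnit (.of_mul_eq_one ⟨_, h1⟩ (Subtype.ext (mul_inv_cancel₀ hϖ0)))
  have main : (redRes β).charpoly.Separable → SchurHypothesis τ hl ϖ β :=
    schurHypothesis_of_separable hl hϖ0 hm ht hτ1 hτ2
  -- The residue field is finite, hence perfect.
  exact ⟨main, fun h => main (PerfectField.separable_of_irreducible h)⟩
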